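/- For a graph $G$ of order $n$ with Laplacian matrix $L(G)$ write $\det(\lambda I_n-L(G))=\sum_{k=0}^n(-1)^kc_k(G)\lambda^{n-k}$. For graphs $G,H$ of order $n$ write $G\preceq H$ if $c_k(G)\le c_k(H)$ for all $0\le k\le n$, and $G\prec H$ if moreover $c_k(G)<c_k(H)$ for some $k$. Let $g\ge 3$, $l\ge 2$ and $n\ge g+l$. Let $\mathcal U_{n,l}^{g,1}$ be the set of unicyclic graphs with $n$ vertices, $l$ leaves and girth $g$ that are obtained from a cycle $u_1u_2\cdots u_g$ by attaching trees $T_1,\dots,T_g$ rooted at $u_1,\dots,u_g$, respectively, where $|V(T_i)|=1$ for $i=2,\dots,g$. Put $$p=\max\Bigl\{0,\Bigl\lfloor\frac{n-g-gl+l}{l+1}\Bigr\rfloor\Bigr\}.$$ For $0\le i\le p$ let $U^i=U_{n,l}^{g,i}$ be the graph of order $n$ obtained from a cycle of order $g$ and a path with $i$ edges by identifying one end of the path with a vertex of the cycle, and the other end $w$ of the path with one end of each of $l$ further paths, each having $\lfloor (n-g-i)/l\rfloor$ or $\lceil (n-g-i)/l\rceil$ edges, with $n-g-i$ edges in total (if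 $i=0$, then $w$ is the cycle vertex itself). Then, up to isomorphism, there are exactly $p+1$ minimal elements of $\mathcal U_{n,l}^{g,1}$ with respect to $\preceq$, namely $U^0,U^1,\dots,U^p$: a graph $G\in\mathcal U_{n,l}^{g,1}$ satisfies $H\not\prec G$ for all $H\in\mathcal U_{n,l}^{g,1}$ if and only if $G\cong U^i$ for some $0\le i\le p$, and the graphs $U^0,\dots,U^p$ are pairwise non-isomorphic and pairwise incomparable with respect to $\preceq$. -/

import Mathlib

open Classical in
/-- The Laplacian coefficient `c_k(G)`, defined by
`det (λ I - L(G)) = ∑ k, (-1) ^ k * c_k(G) * λ ^ (n - k)` where `n` is the order of `G`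
(meaningful for `k ≤ n`). -/
noncomputable def lapCoeff {V : Type*} [Fintype V] (G : SimpleGraph V) (k : ℕ) : ℤ :=
  (-1) ^ k * (G.lapMatrix ℤ).charpoly.coeff (Fintype.card V - k)

/-- `G ≼ H`: the graphs have the same order `n`, and `c_k(G) ≤ c_k(H)` for all `0 ≤ k ≤ n`. -/
def LapLE {V W : Type*} [Fintype V] [Fintype W] (G : SimpleGraph V) (H : SimpleGraph W) : Prop :=
  Fintype.card V = Fintype.card W ∧ ∀ k ≤ Fintype.card V, lapCoeff G k ≤ lapCoeff H k

/-- `G ≺ H`: `G ≼ H`, and `c_k(G) < c_k(H)` for some `0 ≤ k ≤ n`. -/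
def LapLT {V W : Type*} [Fintype V] [Fintype W] (G : SimpleGraph V) (H : SimpleGraph W) : Prop :=
  LapLE G H ∧ ∃ k ≤ Fintype.card V, lapCoeff G k < lapCoeff H k

/-- A unicyclic graph: connected, with as many edges as vertices. -/
def IsUnicyclic {V : Type*} (G : SimpleGraph V) : Prop :=
  G.Connected ∧ G.edgeSet.ncard = Nat.card V

/-- The number of leaves (vertices of degree one). -/
noncomputable def numLeaves {V : Type*} (G : SimpleGraph V) : ℕ :=
  {v : V | (G.neighborSet v).ncard = 1}.ncard

/-- The `n`-vertex unicyclic graphs with `l` leaves and girth `g`. -/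
def unicyclicClass (n l g : ℕ) : Set (SimpleGraph (Fin n)) :=
  {G | IsUnicyclic G ∧ numLeaves G = l ∧ G.girth = g}

/-- The graph `C_{T_1, …, T_g}` obtained from a cycle of order `g` by attaching at its `i`-th vertex
the graph `T i` rooted at `r i`; the `i`-th cycle vertex is the root `⟨i, r i⟩`. -/
def cycleAttach {g : ℕ} {V : Fin g → Type} (T : ∀ i, SimpleGraph (V i)) (r : ∀ i, V i) :
    SimpleGraph (Σ i, V i) where
  Adj a b :=
    (∃ i x y, a = ⟨i, x⟩ ∧ b = ⟨i, y⟩ ∧ (T i).Adj x y) ∨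
      (a.2 = r a.1 ∧ b.2 = r b.1 ∧ (SimpleGraph.cycleGraph g).Adj a.1 b.1)
  symm := ⟨by
    rintro a b (⟨i, x, y, ha, hb, h⟩ | ⟨ha, hb, h⟩)
    · exact Or.inl ⟨i, y, x, hb, ha, h.symm⟩
    · exact Or.inr ⟨hb, ha, h.symm⟩⟩
  loopless := ⟨by
    rintro a (⟨i, x, y, ha, hb, h⟩ | ⟨_, _, h⟩)
    · obtain rfl : x = y := eq_of_heq (Sigma.mk.inj (ha.symm.trans hb)).2
      exact (T i).loopless.irrefl x h
    · exact (SimpleGraph.cycleGraph g).loopless.irrefl _ h⟩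

/-- The graphs `C_{T_1, …, T_g}` among the `n`-vertex unicyclic graphs with `l` leaves and girth `g`
for which the trees `T_2, …, T_g` have only one vertex. -/
def singleRootClass (n l g : ℕ) : Set (SimpleGraph (Fin n)) :=
  {G | G ∈ unicyclicClass n l g ∧
    ∃ (V : Fin g → Type) (T : ∀ i, SimpleGraph (V i)) (r : ∀ i, V i),
      (∀ i, (T i).IsTree) ∧ (∀ i, i.val ≠ 0 → Nat.card (V i) = 1) ∧
        Nonempty (G ≃g cycleAttach T r)}

/-- `G` is a minimal element of `S` with respect to `≼`. -/
def IsLapMinimal {n : ℕ} (S : Set (SimpleGraph (Fin n))) (G : SimpleGraph (Fin n)) : Prop :=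
  G ∈ S ∧ ∀ H ∈ S, ¬ LapLT H G

/-- The lengths of `l` balanced legs with `N` vertices altogether (their common centre not
counted): `N % l` of them have length `⌊N / l⌋ + 1`, the others `⌊N / l⌋`. -/
def legLength (N l : ℕ) (j : Fin l) : ℕ :=
  if j.val < N % l then N / l + 1 else N / l

/-- The vertices of the balanced starlike unicyclic graph: the `g` cycle vertices,
the `p` vertices `w_1, …, w_p` of the connecting path other than its end on the cycle, and
the vertices of the `l` balanced legs, which contain the remaining `n - g - p` vertices. -/
abbrev StarUniVertex (n l g p : ℕ) : Type :=
  Fin g ⊕ Fin p ⊕ (Σ j : Fin l, Fin (legLength (n - g - p) l j))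

/-- The adjacencies (in one direction) of the balanced starlike unicyclic graph.
The centre of the legs is the last path vertex `w_p`, and the cycle vertex `0` if `p = 0`. -/
def StarUniRel (n l g p : ℕ) : StarUniVertex n l g p → StarUniVertex n l g p → Prop
  | .inl a, .inl b => (SimpleGraph.cycleGraph g).Adj a b
  | .inl a, .inr (.inl b) => a.val = 0 ∧ b.val = 0
  | .inl a, .inr (.inr ⟨_, m⟩) => p = 0 ∧ a.val = 0 ∧ m.val = 0
  | .inr (.inl a), .inr (.inl b) => b.val = a.val + 1
  | .inr (.inl a), .inr (.inr ⟨_, m⟩) => a.val + 1 = p ∧ m.val = 0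
  | .inr (.inr ⟨j, m⟩), .inr (.inr ⟨j', m'⟩) => j = j' ∧ m'.val = m.val + 1
  | _, _ => False

/-- The balanced starlike unicyclic graph `U_{n,l}^{g,p}`: a cycle of order `g` and the centre of a
balanced starlike tree of order `n - p - g + 1` with `l` leaves, joined by a path of length `p`. -/
def starUni (n l g p : ℕ) : SimpleGraph (StarUniVertex n l g p) :=
  SimpleGraph.fromRel (StarUniRel n l g p)

/-! The `c_k` are the coefficients of `det (1 + X L)`. For a rooted graph keep this determinant `A`
together with the minor `B` obtained by grounding the root. Identifying roots multiplies the `B` and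
adds the quotients `(A - B) / B`; joining the root to a new root is a linear map of `(A, B)` with
determinant `X ^ 2`. Hence each graph of the class has as its determinant the total of the product
of the pair of the cycle and the pair of a plane tree, and `≼` becomes nonnegativity of the
coefficients of explicit polynomials.

One quantity governs all moves: `LapPair.excess`, the determinant `A b_m - B a_m` of a pair against
the pair `(a_m, b_m)` of a path with `m` edges. The difference of two configurations factors through
an excess. Inside the tree a move with an excess of the right sign is always available, so a tree
that is not a stem followed by legs, or that has two legs differing by at least two, can be improved
(`exists_stem_legs_or_reducible`, `reducible_legs`).

Only the length of the stem remains. Shortening it by one edge and lengthening a leg changes the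
determinant by a factor times the excess of the cycle with the shorter stem. The excess of a cycle
of order `g` is positive against paths with at most `g - 1` edges (`pos_excess_cyc`), so a stem with
`i ≥ 1` edges survives only if all legs have at least `g - 1 + i` edges; this is `i ≤ p`. Beyond
that threshold the excess starts with a positive and ends with a negative coefficient
(`excess_cyc_coeff`), so passing from `U^i` to `U^{i+1}` raises `c_{2i+2}` and lowers `c_{n-2}`: the
`U^i` are incomparable. As the class is finite, a graph below some `U^i` would yield a minimal one
below it, which is some `U^j`, a contradiction. -/

open Polynomial

noncomputable section

/-! ### Polynomials with nonnegative coefficients -/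

/-- A polynomial all of whose coefficients are nonnegative. -/
def NonnegCoeff (p : ℤ[X]) : Prop := ∀ k, 0 ≤ p.coeff k

namespace NonnegCoeff

theorem zero : NonnegCoeff 0 := fun k => by simp

theorem one : NonnegCoeff 1 := fun k => by
  rw [coeff_one]; split_ifs <;> simp

theorem X_pow (m : ℕ) : NonnegCoeff (X ^ m) := fun k => by
  rw [coeff_X_pow]; split_ifs <;> simp

theorem X : NonnegCoeff X := by simpa using X_pow 1

theorem add {p q : ℤ[X]} (hp : NonnegCoeff p) (hq : NonnegCoeff q) : NonnegCoeff (p + q) :=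
  fun k => by rw [coeff_add]; exact add_nonneg (hp k) (hq k)

theorem mul {p q : ℤ[X]} (hp : NonnegCoeff p) (hq : NonnegCoeff q) : NonnegCoeff (p * q) :=
  fun k => by
    rw [coeff_mul]
    exact Finset.sum_nonneg fun x _ => mul_nonneg (hp _) (hq _)

theorem eval_one {p : ℤ[X]} (hp : NonnegCoeff p) : 0 ≤ p.eval 1 := by
  rw [eval_eq_sum_range]
  exact Finset.sum_nonneg fun i _ => by simpa using hp i

end NonnegCoeff

/-- A polynomial with nonnegative coefficients that is not zero. -/
def PosCoeff (p : ℤ[X]) : Prop := NonnegCoeff p ∧ 0 < p.eval 1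

namespace PosCoeff

theorem one : PosCoeff 1 := ⟨.one, by simp⟩

theorem X_pow (m : ℕ) : PosCoeff (X ^ m) := ⟨.X_pow m, by simp⟩

theorem X : PosCoeff X := ⟨.X, by simp⟩

theorem mul {p q : ℤ[X]} (hp : PosCoeff p) (hq : PosCoeff q) : PosCoeff (p * q) :=
  ⟨hp.1.mul hq.1, by rw [eval_mul]; exact mul_pos hp.2 hq.2⟩

theorem add {p q : ℤ[X]} (hp : PosCoeff p) (hq : NonnegCoeff q) : PosCoeff (p + q) :=
  ⟨hp.1.add hq, by rw [eval_add]; exact add_pos_of_pos_of_nonneg hp.2 hq.eval_one⟩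

theorem add' {p q : ℤ[X]} (hp : NonnegCoeff p) (hq : PosCoeff q) : PosCoeff (p + q) :=
  add_comm q p ▸ hq.add hp

end PosCoeff

/-! ### The algebra of pairs of rooted graphs -/

/-- The pair formed by the polynomial `det (1 + X L)` of a rooted graph and the polynomial obtained
from it by replacing the row of the root by the corresponding row of the identity matrix. -/
@[ext] structure LapPair where
  total : ℤ[X]
  ground : ℤ[X]

namespace LapPair

/-- The product corresponds to the identification of the roots of two rooted graphs. -/
instance : CommMonoid LapPair where
  mul u v := ⟨u.total * v.ground + u.ground * v.total - u.ground * v.ground, u.ground * v.ground⟩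
  one := ⟨1, 1⟩
  mul_assoc u v w := by
    ext1
    · change (u.total * v.ground + u.ground * v.total - u.ground * v.ground) * w.ground +
        u.ground * v.ground * w.total - u.ground * v.ground * w.ground =
        u.total * (v.ground * w.ground) + u.ground *
        (v.total * w.ground + v.ground * w.total - v.ground * w.ground) -
        u.ground * (v.ground * w.ground)
      ring
    · exact mul_assoc _ _ _
  one_mul u := by
    ext1
    · change 1 * u.ground + 1 * u.total - 1 * u.ground = u.total
      ring
    · exact one_mul _
  mul_one u := by
    ext1
    · change u.total * 1 + u.ground * 1 - u.ground * 1 = u.total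
      ring
    · exact mul_one _
  mul_comm u v := by
    ext1
    · change u.total * v.ground + u.ground * v.total - u.ground * v.ground =
        v.total * u.ground + v.ground * u.total - v.ground * u.ground
      ring
    · exact mul_comm _ _

@[simp] theorem total_one : (1 : LapPair).total = 1 := rfl
@[simp] theorem ground_one : (1 : LapPair).ground = 1 := rfl
theorem total_mul (u v : LapPair) :
    (u * v).total = u.total * v.ground + u.ground * v.total - u.ground * v.ground := rfl
@[simp] theorem ground_mul (u v : LapPair) : (u * v).ground = u.ground * v.ground := rfl

/-- The difference of the two polynomials. -/
def diff (u : LapPair) : ℤ[X] := u.total - u.ground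

theorem total_eq (u : LapPair) : u.total = u.diff + u.ground := by simp [diff]

/-- Equivalently, `diff / ground` is additive. -/
theorem diff_mul (u v : LapPair) :
    (u * v).diff = u.diff * v.ground + u.ground * v.diff := by
  simp only [diff, total_mul, ground_mul]; ring

theorem total_mul' (u v : LapPair) :
    (u * v).total = u.total * v.ground + u.ground * v.diff := by
  simp only [diff, total_mul]; ring

/-- The effect of joining the root to a new vertex, which becomes the root. -/
def hang (u : LapPair) : LapPair := ⟨(1 + X) * u.total + X * u.ground, u.total + X * u.ground⟩

theorem total_hang (u : LapPair) : u.hang.total = (1 + X) * u.total + X * u.ground := rfl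
theorem ground_hang (u : LapPair) : u.hang.ground = u.total + X * u.ground := rfl
theorem diff_hang (u : LapPair) : u.hang.diff = X * u.total := by
  simp only [diff, hang]; ring

/-- `hang` is linear, and its powers keep the shape of its matrix, which is the case `r = 1`, `q =
X`. In the moves below only `r` survives, so its positivity for `d ≥ 1` gives strictness. -/
theorem exists_hang_iterate (d : ℕ) : ∃ r q : ℤ[X], NonnegCoeff r ∧ NonnegCoeff q ∧
    (1 ≤ d → PosCoeff r) ∧ ∀ u : LapPair, hang^[d] u =
      ⟨(r + q) * u.total + X * r * u.ground, r * u.total + q * u.ground⟩ := by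
  induction d with
  | zero => exact ⟨0, 1, .zero, .one, by simp, fun u => by simp⟩
  | succ d ih =>
    obtain ⟨r, q, hr, hq, h1, h⟩ := ih
    have hrq : PosCoeff (r + q) := by
      rcases Nat.eq_zero_or_pos d with rfl | hd
      · have := congrArg ground (h ⟨0, 1⟩)
        simp at this
        exact .add' hr (this ▸ .one)
      · exact (h1 hd).add hq
    refine ⟨r + q + X * r, X * r + X * q, ?_, ?_, fun _ => ?_, fun u => ?_⟩
    · exact hrq.1.add (.mul .X hr)
    · exact (NonnegCoeff.X.mul hr).add (.mul .X hq)
    · exact hrq.add (.mul .X hr)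
    · rw [Function.iterate_succ_apply', h]
      ext1 <;> simp only [hang] <;> ring

/-- The conditions satisfied by the pairs of rooted graphs. -/
structure Good (u : LapPair) : Prop where
  diff : NonnegCoeff u.diff
  ground : PosCoeff u.ground

namespace Good

theorem one : Good 1 := ⟨by simpa [LapPair.diff] using .zero, .one⟩

theorem total {u : LapPair} (hu : Good u) : PosCoeff u.total :=
  u.total_eq ▸ .add' hu.diff hu.ground

theorem mul {u v : LapPair} (hu : Good u) (hv : Good v) : Good (u * v) :=
  ⟨by rw [diff_mul]; exact (hu.diff.mul hv.ground.1).add (hu.ground.1.mul hv.diff),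
    hu.ground.mul hv.ground⟩

theorem pos_diff_hang {u : LapPair} (hu : Good u) : PosCoeff u.hang.diff := by
  rw [diff_hang]; exact PosCoeff.X.mul hu.total

theorem hang {u : LapPair} (hu : Good u) : Good u.hang :=
  ⟨hu.pos_diff_hang.1, by rw [ground_hang]; exact hu.total.add (.mul .X hu.ground.1)⟩

theorem hang_iterate {u : LapPair} (hu : Good u) (d : ℕ) : Good (LapPair.hang^[d] u) := by
  induction d with
  | zero => exact hu
  | succ d ih => rw [Function.iterate_succ_apply']; exact ih.hang

end Good

/-- Strict comparison of pairs. -/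
def Less (u v : LapPair) : Prop :=
  (NonnegCoeff (v.total - u.total) ∧ NonnegCoeff (v.ground - u.ground)) ∧
    (PosCoeff (v.total - u.total) ∨ PosCoeff (v.ground - u.ground))

namespace Less

theorem hang {u v : LapPair} (h : Less u v) : Less u.hang v.hang := by
  have h1 : v.hang.total - u.hang.total =
      (v.total - u.total) + X * (v.total - u.total) + X * (v.ground - u.ground) := by
    simp only [total_hang]; ring
  have h2 : v.hang.ground - u.hang.ground = (v.total - u.total) + X * (v.ground - u.ground) := by
    simp only [ground_hang]; ring
  refine ⟨⟨?_, ?_⟩, .inl ?_⟩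
  · rw [h1]; exact (h.1.1.add (.mul .X h.1.1)).add (.mul .X h.1.2)
  · rw [h2]; exact h.1.1.add (.mul .X h.1.2)
  · rw [h1]
    rcases h.2 with h' | h'
    · exact (h'.add (.mul .X h.1.1)).add (.mul .X h.1.2)
    · exact .add' (h.1.1.add (.mul .X h.1.1)) (PosCoeff.X.mul h')

theorem mul {u v : LapPair} (h : Less u v) {w : LapPair} (hw : Good w) : Less (u * w) (v * w) := by
  have h1 : (v * w).total - (u * w).total =
      (v.total - u.total) * w.ground + (v.ground - u.ground) * w.diff := by
    simp only [total_mul, LapPair.diff]; ring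
  have h2 : (v * w).ground - (u * w).ground = (v.ground - u.ground) * w.ground := by
    simp only [ground_mul]; ring
  refine ⟨⟨?_, ?_⟩, ?_⟩
  · rw [h1]; exact (h.1.1.mul hw.ground.1).add (h.1.2.mul hw.diff)
  · rw [h2]; exact h.1.2.mul hw.ground.1
  · rcases h.2 with h' | h'
    · left; rw [h1]; exact (h'.mul hw.ground).add (h.1.2.mul hw.diff)
    · right; rw [h2]; exact h'.mul hw.ground

/-- Whole graphs are compared by totals only; a nonzero `w.diff` makes a strict inequality of
grounds visible there. -/
theorem total_mul {u v : LapPair} (h : Less u v) {w : LapPair} (hw : Good w)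
    (hd : PosCoeff w.diff) : PosCoeff ((v * w).total - (u * w).total) := by
  have h1 : (v * w).total - (u * w).total =
      (v.total - u.total) * w.ground + (v.ground - u.ground) * w.diff := by
    simp only [LapPair.total_mul, LapPair.diff]; ring
  rw [h1]
  rcases h.2 with h' | h'
  · exact (h'.mul hw.ground).add (h.1.2.mul hw.diff)
  · exact .add' (h.1.1.mul hw.ground.1) (h'.mul hd)

end Less

/-- Both sides are two rooted graphs with an edge between their roots; only the end serving as root
differs, and the total does not depend on it. -/
theorem total_mul_hang (u v : LapPair) : (u * v.hang).total = (u.hang * v).total := by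
  simp only [total_mul, total_hang, ground_hang]; ring

theorem total_mul_hang_iterate (u v : LapPair) (i : ℕ) :
    (u * hang^[i] v).total = (hang^[i] u * v).total := by
  induction i generalizing u with
  | zero => rfl
  | succ i ih => rw [Function.iterate_succ_apply', total_mul_hang, ih]; rfl

/-! ### Comparison with paths: the excess -/

/-- The pair of a path with `m` edges, rooted at an end. -/
def leg (m : ℕ) : LapPair := hang^[m] 1

theorem leg_succ (m : ℕ) : leg (m + 1) = (leg m).hang := Function.iterate_succ_apply' _ _ _

@[simp] theorem leg_zero : leg 0 = 1 := rfl

theorem hang_iterate_leg (d m : ℕ) : hang^[d] (leg m) = leg (d + m) :=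
  (Function.iterate_add_apply _ _ _ _).symm

theorem good_leg (m : ℕ) : Good (leg m) := Good.one.hang_iterate m

/-- The difference `A b_m - B a_m`, where `(A, B)` is the given pair and `(a_m, b_m)` the pair of
the path with `m` edges. -/
def excess (u : LapPair) (m : ℕ) : ℤ[X] := u.total * (leg m).ground - u.ground * (leg m).total

theorem excess_zero (u : LapPair) : u.excess 0 = u.diff := by simp [excess, diff]

/-- A 2×2 determinant whose two columns are both acted on by `hang`, of determinant `X ^ 2`. -/
theorem excess_hang (u : LapPair) (m : ℕ) : u.hang.excess (m + 1) = X ^ 2 * u.excess m := by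
  simp only [excess, leg_succ, total_hang, ground_hang]; ring

theorem excess_hang_iterate (u : LapPair) (d m : ℕ) :
    (hang^[d] u).excess (d + m) = X ^ (2 * d) * u.excess m := by
  induction d with
  | zero => simp
  | succ d ih =>
    rw [Function.iterate_succ_apply', show d + 1 + m = d + m + 1 by ring, excess_hang, ih]; ring

theorem excess_mul (u v : LapPair) (m : ℕ) :
    (u * v).excess m = u.excess m * v.ground + u.ground * (leg m).ground * v.diff := by
  simp only [excess, total_mul', ground_mul]; ring

/-- Edges are stripped from the stem and from the path simultaneously. Either the stem is used up
first and the hypothesis applies, or the path is, and the `diff` of a hung pair remains. -/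
theorem pos_excess_hang_iterate {u : LapPair} (hu : Good u) {M : ℕ}
    (h : ∀ m ≤ M, PosCoeff (u.excess m)) (d : ℕ) {m : ℕ} (hm : m ≤ d + M) :
    PosCoeff ((hang^[d] u).excess m) := by
  rcases le_or_gt d m with hd | hd
  · obtain ⟨c, rfl⟩ := Nat.exists_eq_add_of_le hd
    rw [excess_hang_iterate]
    exact (PosCoeff.X_pow _).mul (h _ (by omega))
  · obtain ⟨c, rfl⟩ := Nat.exists_eq_add_of_lt hd
    have h1 : hang^[m + c + 1] u = hang^[m] (hang (hang^[c] u)) := by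
      rw [← Function.iterate_succ_apply' hang, ← Function.iterate_add_apply, add_assoc]
    rw [h1]
    have h2 := excess_hang_iterate (hang (hang^[c] u)) m 0
    rw [add_zero] at h2
    rw [h2, excess_zero]
    exact (PosCoeff.X_pow _).mul (hu.hang_iterate c).pos_diff_hang

theorem nonneg_excess_hang_iterate {u : LapPair} (hu : Good u) {M : ℕ}
    (h : ∀ m ≤ M, NonnegCoeff (u.excess m)) (d : ℕ) {m : ℕ} (hm : m ≤ d + M) :
    NonnegCoeff ((hang^[d] u).excess m) := by
  rcases le_or_gt d m with hd | hd
  · obtain ⟨c, rfl⟩ := Nat.exists_eq_add_of_le hd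
    rw [excess_hang_iterate]
    exact (NonnegCoeff.X_pow _).mul (h _ (by omega))
  · obtain ⟨c, rfl⟩ := Nat.exists_eq_add_of_lt hd
    have h1 : hang^[m + c + 1] u = hang^[m] (hang (hang^[c] u)) := by
      rw [← Function.iterate_succ_apply' hang, ← Function.iterate_add_apply, add_assoc]
    rw [h1]
    have h2 := excess_hang_iterate (hang (hang^[c] u)) m 0
    rw [add_zero] at h2
    rw [h2, excess_zero]
    exact (NonnegCoeff.X_pow _).mul (hu.hang_iterate c).pos_diff_hang.1

theorem pos_excess_leg {m a : ℕ} (h : a < m) : PosCoeff ((leg m).excess a) := by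
  have : leg m = hang^[m] (1 : LapPair) := rfl
  obtain ⟨c, rfl⟩ := Nat.exists_eq_add_of_lt h
  have h1 := excess_hang_iterate (leg (c + 1)) a 0
  rw [add_zero, hang_iterate_leg, excess_zero, ← add_assoc] at h1
  rw [h1, leg_succ]
  exact (PosCoeff.X_pow _).mul (good_leg c).pos_diff_hang

theorem nonneg_excess_leg {m a : ℕ} (h : a ≤ m) : NonnegCoeff ((leg m).excess a) := by
  rcases h.lt_or_eq with h | rfl
  · exact (pos_excess_leg h).1
  · rw [excess, mul_comm, sub_self]; exact .zero

theorem pos_excess_leg_mul {m a : ℕ} (h : a < m) {v : LapPair} (hv : Good v) :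
    PosCoeff ((leg m * v).excess a) := by
  rw [excess_mul]
  exact ((pos_excess_leg h).mul hv.ground).add
    (((good_leg m).ground.1.mul (good_leg a).ground.1).mul hv.diff)

theorem nonneg_excess_leg_mul {m a : ℕ} (h : a ≤ m) {v : LapPair} (hv : Good v) :
    NonnegCoeff ((leg m * v).excess a) := by
  rw [excess_mul]
  exact ((nonneg_excess_leg h).mul hv.ground.1).add
    (((good_leg m).ground.1.mul (good_leg a).ground.1).mul hv.diff)

/-- Moving the branches `h` from the far end of a path to its near end. -/
theorem less_of_nonneg_excess {d a : ℕ} (hd : 1 ≤ d) {h z : LapPair} (hh : PosCoeff h.diff)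
    (hz : Good z) (he : NonnegCoeff (z.excess a)) :
    Less (leg (d + a) * h * z) (hang^[d] (leg a * h) * z) := by
  obtain ⟨r, q, hr, hq, hr1, H⟩ := exists_hang_iterate d
  -- Both differences are linear in `(r, q)`. The part in `q` vanishes, since `r = 0`, `q = 1` is
  -- the stem of length zero, for which the two graphs agree.
  have hA : (hang^[d] (leg a * h) * z).total - (leg (d + a) * h * z).total =
      r * h.diff * z.excess a := by
    rw [← hang_iterate_leg, H, H]; simp only [total_mul, ground_mul, excess, LapPair.diff]; ring
  have hB : (hang^[d] (leg a * h) * z).ground - (leg (d + a) * h * z).ground =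
      r * (leg a).ground * h.diff * z.ground := by
    rw [← hang_iterate_leg, H, H]; simp only [total_mul, ground_mul, LapPair.diff]; ring
  have hB' := (((hr1 hd).mul (good_leg a).ground).mul hh).mul hz.ground
  rw [← hB] at hB'
  refine ⟨⟨?_, hB'.1⟩, .inr hB'⟩
  rw [hA]
  exact (hr.mul hh.1).mul he

/-- Moving the root to the far end of a path. -/
theorem less_of_pos_excess {d b : ℕ} (hd : 1 ≤ d) {x z : LapPair} (hz : Good z)
    (he : PosCoeff (x.excess b)) :
    Less (x * leg (d + b) * z) (hang^[d] x * leg b * z) := by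
  obtain ⟨r, q, hr, hq, hr1, H⟩ := exists_hang_iterate d
  have hA : (hang^[d] x * leg b * z).total - (x * leg (d + b) * z).total =
      r * x.excess b * z.diff := by
    rw [← hang_iterate_leg, H, H]; simp only [total_mul, ground_mul, excess, LapPair.diff]; ring
  have hB : (hang^[d] x * leg b * z).ground - (x * leg (d + b) * z).ground =
      r * x.excess b * z.ground := by
    rw [← hang_iterate_leg, H, H]; simp only [ground_mul, excess]; ring
  have hB' := ((hr1 hd).mul he).mul hz.ground
  rw [← hB] at hB'
  refine ⟨⟨?_, hB'.1⟩, .inr hB'⟩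
  rw [hA]
  exact (hr.mul he.1).mul hz.diff

/-- Used with `z` the cycle and its stem: the edge between `z` and the centre is removed and added
to a leg. -/
theorem total_hang_leg_mul_sub (z h : LapPair) (a : ℕ) :
    (z * (leg a * h).hang).total - (z * (leg (a + 1) * h)).total = h.diff * z.excess a := by
  simp only [total_mul, ground_mul, excess, LapPair.diff, leg_succ, hang]; ring

/-! ### The pair of a cycle -/

/-- The pair of a cycle with `k + 1` vertices. -/
def cyc (k : ℕ) : LapPair :=
  ⟨2 * X * ((leg k).ground - X ^ k) + (leg k).total, (leg k).total⟩

theorem diff_cyc (k : ℕ) : (cyc k).diff = 2 * X * ((leg k).ground - X ^ k) := by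
  simp [cyc, diff]

theorem leg_ground_succ (k : ℕ) : (leg (k + 1)).ground = (leg k).total + X * (leg k).ground := by
  rw [leg_succ, ground_hang]

theorem leg_ground_add_sub (j m : ℕ) :
    NonnegCoeff ((leg (j + m)).ground - X ^ j * (leg m).ground) := by
  induction j with
  | zero => simpa using .zero
  | succ j ih =>
    rw [show j + 1 + m = j + m + 1 by ring, leg_ground_succ, pow_succ]
    have h := (good_leg (j + m)).total.1.add (NonnegCoeff.X.mul ih)
    refine cast (congrArg NonnegCoeff ?_) h
    ring

theorem pos_leg_ground_sub {k : ℕ} (hk : 1 ≤ k) : PosCoeff ((leg k).ground - X ^ k) := by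
  obtain ⟨k, rfl⟩ := Nat.exists_eq_add_of_le' hk
  rw [leg_ground_succ]
  have h0 := leg_ground_add_sub k 0
  simp at h0
  have h := (good_leg k).total.add (NonnegCoeff.X.mul h0)
  refine cast (congrArg PosCoeff ?_) h
  ring

theorem nonneg_leg_ground_sub (k : ℕ) : NonnegCoeff ((leg k).ground - X ^ k) := by
  simpa using leg_ground_add_sub k 0

theorem good_cyc (k : ℕ) : Good (cyc k) :=
  ⟨by
    rw [diff_cyc, mul_assoc, two_mul]
    exact (NonnegCoeff.X.mul (nonneg_leg_ground_sub k)).add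
      (NonnegCoeff.X.mul (nonneg_leg_ground_sub k)), (good_leg k).total⟩

theorem pos_diff_cyc {k : ℕ} (hk : 1 ≤ k) : PosCoeff (cyc k).diff := by
  rw [diff_cyc, mul_assoc, two_mul]
  exact (PosCoeff.X.mul (pos_leg_ground_sub hk)).add (.mul .X (nonneg_leg_ground_sub k))

theorem excess_cyc_succ (k m : ℕ) : (cyc k).excess (m + 1) =
    X * (2 * ((leg k).ground - X ^ k) * (leg (m + 1)).ground - (leg k).total * (leg m).total) := by
  simp only [excess, cyc, leg_succ, hang]; ring

/-- A Cassini-type identity; each induction step multiplies the correction term by `X ^ 2`, the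
determinant of `hang`. -/
theorem leg_ground_mul (j m : ℕ) : (leg (j + m + 1)).ground * (leg (m + 1)).ground =
    (leg (j + m + 1)).total * (leg m).total + X ^ (2 * (m + 1)) * (leg j).ground := by
  induction m with
  | zero => simp only [leg_succ, hang, add_zero, leg_zero, total_one, ground_one]; ring
  | succ m ih =>
    rw [← add_assoc]
    rw [leg_succ (j + m + 1), leg_succ (m + 1)]
    simp only [hang]
    have h : (leg (m + 1)).total = (leg (m + 1)).ground + X * (leg m).total := by
      rw [leg_succ]; simp only [hang]; ring
    linear_combination X ^ 2 * ih + (-X * (leg (j + m + 1)).total) * h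

/-- The range of `m` is sharp: beyond it the top coefficient is negative, see `excess_cyc_coeff`. -/
theorem pos_excess_cyc {k m : ℕ} (hk : 1 ≤ k) (hm : m ≤ k) : PosCoeff ((cyc k).excess m) := by
  rcases m with _ | m
  · rw [excess_zero]; exact pos_diff_cyc hk
  · obtain ⟨j, rfl⟩ := Nat.exists_eq_add_of_le' hm
    -- This grouping absorbs the negative term `-2 X ^ k b_{m+1}` left by `leg_ground_mul` (where `k
    -- = j + m + 1`) into differences `b_{s+t} - X ^ s b_t`, which have nonnegative coefficients.
    have h : 2 * ((leg (j + m + 1)).ground - X ^ (j + m + 1)) * (leg (m + 1)).ground -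
        (leg (j + m + 1)).total * (leg m).total =
        ((leg (m + 1)).ground - X ^ (m + 1)) * ((leg (j + m + 1)).ground - X ^ (j + m + 1)) +
        X ^ (m + 1) * (X ^ (m + 1) * ((leg j).ground - X ^ j) +
          ((leg (j + m + 1)).ground - X ^ j * (leg (m + 1)).ground)) := by
      linear_combination leg_ground_mul j m
    rw [excess_cyc_succ, ← add_assoc, h]
    refine PosCoeff.X.mul (((pos_leg_ground_sub (by omega)).mul (pos_leg_ground_sub hk)).add ?_)
    refine (NonnegCoeff.X_pow _).mul (((NonnegCoeff.X_pow _).mul (nonneg_leg_ground_sub j)).add ?_)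
    exact leg_ground_add_sub j (m + 1)

end LapPair

/-! ### Plane trees and their reduction to a stem with legs -/

/-- Rooted plane trees: a single vertex, or a tree `t` with a further branch, the tree `s`, whose
root is joined to the root of `t`. -/
inductive PlaneTree : Type
  | nil : PlaneTree
  | cons (s t : PlaneTree) : PlaneTree

namespace PlaneTree

/-- The number of edges. -/
def size : PlaneTree → ℕ
  | nil => 0
  | cons s t => s.size + 1 + t.size

/-- The number of leaves other than the root. -/
def leaves : PlaneTree → ℕ
  | nil => 0
  | cons s t => max s.leaves 1 + t.leaves

/-- The pair of polynomials of a rooted tree. -/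
def pair : PlaneTree → LapPair
  | nil => 1
  | cons s t => s.pair.hang * t.pair

theorem good_pair : ∀ t : PlaneTree, t.pair.Good
  | nil => .one
  | cons s t => s.good_pair.hang.mul t.good_pair

/-- The tree obtained by identifying the roots of two trees. -/
def append : PlaneTree → PlaneTree → PlaneTree
  | nil, t => t
  | cons a s, t => cons a (append s t)

@[simp] theorem size_append : ∀ s t : PlaneTree, (s.append t).size = s.size + t.size
  | nil, t => by simp [append, size]
  | cons a s, t => by simp [append, size, size_append s t]; ring

@[simp] theorem leaves_append : ∀ s t : PlaneTree, (s.append t).leaves = s.leaves + t.leaves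
  | nil, t => by simp [append, leaves]
  | cons a s, t => by simp [append, leaves, leaves_append s t]; ring

@[simp] theorem pair_append : ∀ s t : PlaneTree, (s.append t).pair = s.pair * t.pair
  | nil, t => by simp [append, pair]
  | cons a s, t => by simp [append, pair, pair_append s t, mul_assoc]

theorem leaves_pos {t : PlaneTree} (h : t ≠ nil) : 1 ≤ t.leaves := by
  cases t with
  | nil => exact absurd rfl h
  | cons s t => simp only [leaves]; omega

/-- The tree obtained by attaching a path with `d` edges to the root, the new root being the other
end of this path. -/
def stem : ℕ → PlaneTree → PlaneTree
  | 0, t => t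
  | d + 1, t => cons (stem d t) nil

@[simp] theorem size_stem (d : ℕ) (t : PlaneTree) : (stem d t).size = d + t.size := by
  induction d with
  | zero => simp [stem]
  | succ d ih => simp [stem, size, ih]; ring

theorem leaves_stem (d : ℕ) {t : PlaneTree} (h : t ≠ nil) : (stem d t).leaves = t.leaves := by
  induction d with
  | zero => simp [stem]
  | succ d ih => simp [stem, leaves, ih, leaves_pos h]

@[simp] theorem pair_stem (d : ℕ) (t : PlaneTree) : (stem d t).pair = LapPair.hang^[d] t.pair := by
  induction d with
  | zero => rfl
  | succ d ih => rw [Function.iterate_succ_apply']; simp [stem, pair, ih]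

theorem stem_add (d e : ℕ) (t : PlaneTree) : stem (d + e) t = stem d (stem e t) := by
  induction d with
  | zero => simp [stem]
  | succ d ih => rw [Nat.succ_add]; simp [stem, ih]

/-- The tree whose branches are paths, with `a + 1` edges for each entry `a` of the list. -/
def legs : List ℕ → PlaneTree
  | [] => nil
  | a :: L => cons (stem a nil) (legs L)

theorem stem_legs_singleton (d a : ℕ) : stem d (legs [a]) = legs [d + a] := by
  have h : ∀ b, legs [b] = stem (b + 1) nil := fun b => rfl
  rw [h, h, ← stem_add, add_assoc]

@[simp] theorem size_legs (L : List ℕ) : (legs L).size = L.sum + L.length := by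
  induction L with
  | nil => rfl
  | cons a L ih => simp [legs, size, ih]; ring

theorem leaves_stem_nil (d : ℕ) : (stem d nil).leaves ≤ 1 := by
  induction d with
  | zero => simp [stem, leaves]
  | succ d ih => simp [stem, leaves, ih]

@[simp] theorem leaves_legs (L : List ℕ) : (legs L).leaves = L.length := by
  induction L with
  | nil => rfl
  | cons a L ih => simp [legs, leaves, ih, leaves_stem_nil]; ring

theorem pair_legs_cons (a : ℕ) (L : List ℕ) :
    (legs (a :: L)).pair = LapPair.leg (a + 1) * (legs L).pair := by
  simp only [legs, pair, pair_stem, LapPair.leg_succ]; rfl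

theorem pair_legs_perm {L L' : List ℕ} (h : L.Perm L') : (legs L).pair = (legs L').pair := by
  have : ∀ L : List ℕ, (legs L).pair = (L.map fun a => LapPair.leg (a + 1)).prod := by
    intro L
    induction L with
    | nil => rfl
    | cons a L ih => rw [pair_legs_cons, ih]; simp
  rw [this, this, (h.map _).prod_eq]

theorem pos_diff_pair {t : PlaneTree} (h : t ≠ nil) : PosCoeff t.pair.diff := by
  cases t with
  | nil => exact absurd rfl h
  | cons s t =>
    rw [pair, LapPair.diff_mul]
    exact (s.good_pair.pos_diff_hang.mul t.good_pair.ground).add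
      (s.good_pair.hang.ground.1.mul t.good_pair.diff)

/-- There is a tree with the same numbers of edges and leaves, but a smaller pair. -/
def Reducible (t : PlaneTree) : Prop :=
  ∃ t' : PlaneTree, t'.size = t.size ∧ t'.leaves = t.leaves ∧ LapPair.Less t'.pair t.pair

theorem Reducible.cons_left {s : PlaneTree} (h : s.Reducible) (t : PlaneTree) :
    (cons s t).Reducible := by
  obtain ⟨s', h1, h2, h3⟩ := h
  exact ⟨cons s' t, by simp [size, h1], by simp [leaves, h2], h3.hang.mul t.good_pair⟩

theorem Reducible.cons_right {t : PlaneTree} (h : t.Reducible) (s : PlaneTree) :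
    (cons s t).Reducible := by
  obtain ⟨t', h1, h2, h3⟩ := h
  refine ⟨cons s t', by simp [size, h1], by simp [leaves, h2], ?_⟩
  simp only [pair]
  rw [mul_comm, mul_comm _ t.pair]
  exact h3.mul s.good_pair.hang

/-- The stem and the leg beyond it become a single leg at the root, and the other branches `h` move
to the root. -/
theorem reducible_of_nonneg_excess {t h z : PlaneTree} {d a : ℕ} (hh : h ≠ nil)
    (hs : t.size = d + 1 + (a + 1) + h.size + z.size) (hl : t.leaves = 1 + h.leaves + z.leaves)
    (hp : t.pair = LapPair.hang^[d + 1] (LapPair.leg (a + 1) * h.pair) * z.pair)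
    (he : NonnegCoeff (z.pair.excess (a + 1))) : t.Reducible := by
  refine ⟨((legs [d + 1 + a]).append h).append z, ?_, ?_, ?_⟩
  · simp [hs]; ring
  · simp [hl]
  · rw [hp]
    simp only [pair_append, pair_legs_cons]
    have := LapPair.less_of_nonneg_excess (d := d + 1) (by omega) (pos_diff_pair hh) z.good_pair he
    simpa [legs, pair, add_assoc] using this

/-- The stem below `x` is cut out and appended to a leg at the root. -/
theorem reducible_of_pos_excess {t x z : PlaneTree} {d b : ℕ} 
    (hs : t.size = d + 1 + x.size + (b + 1) + z.size) (hl : t.leaves = x.leaves + 1 + z.leaves)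
    (hp : t.pair = LapPair.hang^[d + 1] x.pair * LapPair.leg (b + 1) * z.pair)
    (he : PosCoeff (x.pair.excess (b + 1))) : t.Reducible := by
  refine ⟨(x.append (legs [d + 1 + b])).append z, ?_, ?_, ?_⟩
  · simp [hs]; ring
  · simp [hl]
  · rw [hp]
    simp only [pair_append, pair_legs_cons]
    have := LapPair.less_of_pos_excess (d := d + 1) (by omega) z.good_pair he
    simpa [legs, pair, add_assoc] using this

/-- A branch that is not a path, next to some path branches. -/
theorem reducible_of_stem_of_legs {t : PlaneTree} (d a b m : ℕ) (L M : List ℕ)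
    (hs : t.size = d + 1 + (legs (a :: b :: L)).size + (legs (m :: M)).size)
    (hl : t.leaves = (legs (a :: b :: L)).leaves + (legs (m :: M)).leaves)
    (hp : t.pair = LapPair.hang^[d + 1] (legs (a :: b :: L)).pair * (legs (m :: M)).pair) :
    t.Reducible := by
  -- The shorter of the legs `a`, `m` decides the move: if `a ≤ m`, the root side has nonnegative
  -- excess against `a + 1`; otherwise the far side has positive excess against `m + 1`.
  rcases le_or_gt a m with h | h
  · refine reducible_of_nonneg_excess (h := legs (b :: L)) (z := legs (m :: M)) (d := d) (a := a)
      (by simp [legs]) ?_ ?_ ?_ ?_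
    · rw [hs]; simp; ring
    · rw [hl]; simp; ring
    · rw [hp, pair_legs_cons a]
    · rw [pair_legs_cons]
      exact LapPair.nonneg_excess_leg_mul (by omega) (good_pair _)
  · refine reducible_of_pos_excess (x := legs (a :: b :: L)) (z := legs M) (d := d) (b := m)
      ?_ ?_ ?_ ?_
    · rw [hs]; simp; ring
    · rw [hl]; simp; ring
    · rw [hp, pair_legs_cons m, mul_assoc]
    · rw [pair_legs_cons]
      exact LapPair.pos_excess_leg_mul (by omega) (good_pair _)

/-- Two branches that are not paths. -/
theorem reducible_of_stem_of_stem {t : PlaneTree} (d e a b m c : ℕ) (L M : List ℕ) (h : a ≤ m)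
    (hs : t.size = d + 1 + (legs (a :: b :: L)).size + (e + (legs (m :: c :: M)).size))
    (hl : t.leaves = (legs (a :: b :: L)).leaves + (legs (m :: c :: M)).leaves)
    (hp : t.pair = LapPair.hang^[d + 1] (legs (a :: b :: L)).pair *
      LapPair.hang^[e] (legs (m :: c :: M)).pair) :
    t.Reducible := by
  refine reducible_of_nonneg_excess (h := legs (b :: L)) (z := stem e (legs (m :: c :: M)))
    (d := d) (a := a) (by simp [legs]) ?_ ?_ ?_ ?_
  · rw [hs]; simp; ring
  · rw [hl, leaves_stem e (by simp [legs])]; simp; ring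
  · rw [hp, pair_legs_cons a, pair_stem]
  · rw [pair_stem]
    refine LapPair.nonneg_excess_hang_iterate (M := m + 1) (good_pair _) (fun k hk => ?_) e
      (by omega)
    rw [pair_legs_cons]
    exact LapPair.nonneg_excess_leg_mul hk (good_pair _)

/-- A reduction of either part reduces the whole, so both parts may be taken to be stems with legs.
A branch at the root that is not a path then tolerates no other branch beside it. -/
theorem exists_stem_legs_or_reducible (t : PlaneTree) :
    (∃ d L, t = stem d (legs L)) ∨ t.Reducible := by
  induction t with
  | nil => exact .inl ⟨0, [], rfl⟩
  | cons s t hs ht =>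
    rcases hs with ⟨d, L, rfl⟩ | hs
    swap
    · exact .inr (hs.cons_left t)
    rcases ht with ⟨e, M, rfl⟩ | ht
    swap
    · exact .inr (ht.cons_right _)
    -- A path is written as `stem d (legs L)` in several ways; here it is normalised to one leg,
    -- separating points, paths and genuine branchings.
    have leg_or : ∀ (d : ℕ) (L : List ℕ), (stem d (legs L) = nil) ∨
        (∃ a, stem d (legs L) = legs [a]) ∨ ∃ a b K, L = a :: b :: K := by
      intro d L
      match d, L with
      | 0, [] => exact .inl rfl
      | d + 1, [] => exact .inr (.inl ⟨d, rfl⟩)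
      | d, [a] => exact .inr (.inl ⟨_, stem_legs_singleton d a⟩)
      | d, a :: b :: K => exact .inr (.inr ⟨a, b, K, rfl⟩)
    have path_case : ∀ r : PlaneTree, (∃ a, r = stem a nil) →
        ∀ e M, (∃ d L, cons r (stem e (legs M)) = stem d (legs L)) ∨
          (cons r (stem e (legs M))).Reducible := by
      rintro r ⟨a, rfl⟩ e M
      rcases leg_or e M with h | ⟨m, h⟩ | ⟨m, c, K, rfl⟩
      · exact .inl ⟨0, [a], by rw [h]; rfl⟩
      · exact .inl ⟨0, [a, m], by rw [h]; rfl⟩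
      · rcases e with _ | e
        · exact .inl ⟨0, a :: m :: c :: K, rfl⟩
        · refine .inr (reducible_of_stem_of_legs e m c a K [] ?_ ?_ ?_)
          · simp [size]; ring
          · have := leaves_stem_nil a
            rw [leaves, leaves_stem (e + 1) (by simp [legs]), max_eq_right this]; simp; ring
          · rw [pair, pair_stem, mul_comm, pair_stem, pair_legs_cons, LapPair.leg_succ]
            simp [legs, pair, LapPair.leg]
    rcases leg_or d L with h | ⟨a, h⟩ | ⟨a, b, K, rfl⟩
    · exact path_case _ ⟨0, h⟩ e M
    · exact path_case _ ⟨a + 1, h⟩ e M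
    · have hne : legs (a :: b :: K) ≠ nil := by simp [legs]
      have hlv := leaves_pos hne
      rcases leg_or e M with h | ⟨m, h⟩ | ⟨m, c, K', rfl⟩
      · exact .inl ⟨d + 1, a :: b :: K, by rw [h]; rfl⟩
      · rw [h]
        refine .inr (reducible_of_stem_of_legs d a b m K [] ?_ ?_ ?_)
        · simp only [size, size_stem]; ring
        · rw [leaves, leaves_stem d hne, max_eq_left hlv]
        · rw [pair, pair_stem, Function.iterate_succ_apply']
      · right
        have hne' : legs (m :: c :: K') ≠ nil := by simp [legs]
        rcases e with _ | e
        · refine reducible_of_stem_of_legs d a b m K (c :: K') ?_ ?_ ?_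
          · simp only [size, size_stem, zero_add]; ring
          · rw [leaves, leaves_stem d hne, max_eq_left hlv]; rfl
          · rw [pair, pair_stem, Function.iterate_succ_apply']; rfl
        rcases le_total a m with ham | ham
        · refine reducible_of_stem_of_stem d (e + 1) a b m c K K' ham ?_ ?_ ?_
          · simp only [size, size_stem]; ring
          · rw [leaves, leaves_stem d hne, max_eq_left hlv, leaves_stem _ hne']
          · rw [pair, pair_stem, pair_stem, Function.iterate_succ_apply' _ d]
        · refine reducible_of_stem_of_stem e (d + 1) m c a b K' K ham ?_ ?_ ?_
          · simp only [size, size_stem]; ring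
          · rw [leaves, leaves_stem d hne, max_eq_left hlv, leaves_stem _ hne']; ring
          · rw [pair, pair_stem, pair_stem, mul_comm, Function.iterate_succ_apply' _ d]

theorem reducible_stem {t : PlaneTree} (h : t.Reducible) (d : ℕ) : (stem d t).Reducible := by
  induction d with
  | zero => exact h
  | succ d ih => exact ih.cons_left nil

/-- Two path branches whose lengths differ by at least two. -/
theorem reducible_legs {L K : List ℕ} {a b : ℕ} (hL : L.Perm (a :: b :: K)) (h : a + 2 ≤ b) :
    (legs L).Reducible := by
  obtain ⟨c, rfl⟩ := Nat.exists_eq_add_of_le' (show 1 ≤ b by omega)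
  -- With `d = 0` one edge moves from the longer leg to the shorter; `c ≥ a + 1` makes the excess
  -- positive.
  refine reducible_of_pos_excess (x := legs [c]) (z := legs K) (d := 0) (b := a) ?_ ?_ ?_ ?_
  · have h1 := hL.sum_eq
    have h2 := hL.length_eq
    simp at h1 h2
    simp [h1, h2]; ring
  · simp [hL.length_eq]; ring
  · rw [pair_legs_perm hL, pair_legs_cons, pair_legs_cons, pair_legs_cons]
    simp only [zero_add, Function.iterate_one]
    rw [LapPair.leg_succ (c + 1), ← mul_assoc, mul_comm (LapPair.leg _) (LapPair.hang _)]
    simp [legs, pair]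
  · rw [pair_legs_cons]
    exact LapPair.pos_excess_leg_mul (by omega) (good_pair _)

end PlaneTree

/-! ### Balanced lists -/

theorem List.sum_eq_of_two_values {q : ℕ} : ∀ {L : List ℕ}, (∀ x ∈ L, x = q ∨ x = q + 1) →
    L.sum = L.length * q + L.count (q + 1) ∧ L.length = L.count q + L.count (q + 1)
  | [], _ => by simp
  | a :: L, h => by
    obtain ⟨h1, h2⟩ := List.sum_eq_of_two_values fun x hx => h x (List.mem_cons_of_mem _ hx)
    rcases h a List.mem_cons_self with rfl | rfl
    · simp only [List.sum_cons, List.length_cons, List.count_cons, h1]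
      simp; constructor <;> nlinarith
    · simp only [List.sum_cons, List.length_cons, List.count_cons, h1]
      simp; constructor <;> nlinarith

theorem List.perm_of_two_values {q : ℕ} {L M : List ℕ} (hL : ∀ x ∈ L, x = q ∨ x = q + 1)
    (hM : ∀ x ∈ M, x = q ∨ x = q + 1) (hs : L.sum = M.sum) (hl : L.length = M.length) :
    L.Perm M := by
  obtain ⟨h1, h2⟩ := List.sum_eq_of_two_values hL
  obtain ⟨h3, h4⟩ := List.sum_eq_of_two_values hM
  rw [List.perm_iff_count]
  intro x
  have e1 : L.count (q + 1) = M.count (q + 1) := by rw [hl] at h1; omega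
  by_cases hx : x = q ∨ x = q + 1
  · rcases hx with rfl | rfl
    · omega
    · exact e1
  · rw [List.count_eq_zero_of_not_mem fun h => hx (hL x h),
      List.count_eq_zero_of_not_mem fun h => hx (hM x h)]

theorem sum_ofFn_legLength (S l : ℕ) (hl : 0 < l) : (List.ofFn (legLength S l)).sum = S := by
  rw [List.sum_ofFn]
  have h1 : ∀ j : Fin l, legLength S l j = S / l + if j.val < S % l then 1 else 0 := by
    intro j; unfold legLength; split_ifs <;> simp
  have h2 : Finset.univ.filter (fun j : Fin l => j.val < S % l) =
      Finset.Iio ⟨S % l, Nat.mod_lt _ hl⟩ := by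
    ext j; simp [Fin.lt_def]
  simp only [h1, Finset.sum_add_distrib, Finset.sum_const, Finset.card_univ, Fintype.card_fin,
    smul_eq_mul, Finset.sum_boole, h2]
  rw [Fin.card_Iio]
  simpa using Nat.div_add_mod S l

theorem mem_ofFn_legLength {S l x : ℕ} (h : x ∈ List.ofFn (legLength S l)) :
    x = S / l ∨ x = S / l + 1 := by
  obtain ⟨j, rfl⟩ := (List.mem_ofFn' _ _).1 h
  unfold legLength; split_ifs <;> simp

theorem exists_perm_of_not_balanced {L : List ℕ} (h : ¬ ∀ a ∈ L, ∀ b ∈ L, b ≤ a + 1) :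
    ∃ a b K, L.Perm (a :: b :: K) ∧ a + 2 ≤ b := by
  push Not at h
  obtain ⟨a, ha, b, hb, hab⟩ := h
  refine ⟨a, b, (L.erase a).erase b, ?_, by omega⟩
  refine (List.perm_cons_erase ha).trans (List.Perm.cons _ (List.perm_cons_erase ?_))
  exact (List.mem_erase_of_ne (by omega)).2 hb

theorem perm_ofFn_legLength {L : List ℕ} {S l : ℕ} (hl : 0 < l) (hL : L.length = l)
    (hS : L.sum = S) (h : ∀ a ∈ L, ∀ b ∈ L, b ≤ a + 1) :
    L.Perm (List.ofFn (legLength S l)) := by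
  have hne : L ≠ [] := by rintro rfl; simp at hL; omega
  obtain ⟨m, hm, hmin⟩ : ∃ m ∈ L, ∀ b ∈ L, m ≤ b :=
    ⟨L.min hne, List.min_mem hne, fun b hb => List.min_le_of_mem hb⟩
  have h2 : ∀ x ∈ L, x = m ∨ x = m + 1 := fun x hx => by
    have := hmin x hx; have := h m hm x hx; omega
  obtain ⟨e1, e2⟩ := List.sum_eq_of_two_values h2
  have hc : 0 < L.count m := List.count_pos_iff.2 hm
  have hq : S / l = m := by
    apply Nat.div_eq_of_lt_le
    · rw [← hS, e1, hL, mul_comm]; omega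
    · rw [← hS, e1, hL, Nat.succ_mul, mul_comm]; omega
  subst hq
  exact List.perm_of_two_values h2 (fun x hx => mem_ofFn_legLength hx)
    (by rw [hS, sum_ofFn_legLength S l hl]) (by simp [hL])

theorem exists_mem_lt_of_sum_lt {c : ℕ} : ∀ {L : List ℕ}, L.sum < L.length * c → ∃ a ∈ L, a < c
  | [], h => by simp at h
  | a :: L, h => by
    by_cases ha : a < c
    · exact ⟨a, by simp, ha⟩
    · obtain ⟨b, hb, hbc⟩ := exists_mem_lt_of_sum_lt (L := L) (c := c) (by
        simp only [List.sum_cons, List.length_cons, Nat.succ_mul] at h; omega)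
      exact ⟨b, by simp [hb], hbc⟩

/-- One more vertex lengthens a shortest leg, so that consecutive `U^i` have all legs but one in
common; `K` lists these. -/
theorem exists_perm_legLength_succ (S l : ℕ) (hl : 0 < l) : ∃ K : List ℕ,
    (List.ofFn (legLength S l)).Perm (S / l :: K) ∧
    (List.ofFn (legLength (S + 1) l)).Perm ((S / l + 1) :: K) := by
  have hmem : S / l ∈ List.ofFn (legLength S l) := by
    rw [List.mem_ofFn']
    -- Since `S % l < l`, the last leg is always a short one.
    refine ⟨⟨l - 1, by omega⟩, ?_⟩
    have := Nat.mod_lt S hl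
    unfold legLength
    rw [if_neg]
    simp only; omega
  have hp := List.perm_cons_erase hmem
  refine ⟨_, hp, ?_⟩
  have hv : ∀ x ∈ (List.ofFn (legLength S l)).erase (S / l), x = S / l ∨ x = S / l + 1 :=
    fun x hx => mem_ofFn_legLength (List.mem_of_mem_erase hx)
  have hs := hp.sum_eq
  have hlen := hp.length_eq
  rw [sum_ofFn_legLength S l hl] at hs
  simp only [List.sum_cons, List.length_cons, List.length_ofFn] at hs hlen
  refine (perm_ofFn_legLength hl ?_ ?_ ?_).symm
  · simp only [List.length_cons]; omega
  · simp only [List.sum_cons]; omega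
  · intro a ha b hb
    have : ∀ x ∈ (S / l + 1) :: (List.ofFn (legLength S l)).erase (S / l),
        x = S / l ∨ x = S / l + 1 := by
      intro x hx
      rcases List.mem_cons.1 hx with rfl | hx
      · exact .inr rfl
      · exact hv x hx
    have h1 := this a ha; have h2 := this b hb; omega

/-! ### Trees attached to a cycle: candidates for minimality -/

namespace PlaneTree

/-- The tree of the graph `U_{n,l}^{g,i}`, where `N = n - g`. -/
def starTree (N l i : ℕ) : PlaneTree :=
  stem i (legs (List.ofFn (legLength (N - i - l) l)))

theorem size_starTree {N l i : ℕ} (hl : 0 < l) (h : i + l ≤ N) : (starTree N l i).size = N := by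
  simp [starTree, sum_ofFn_legLength _ l hl]; omega

theorem leaves_starTree {N l i : ℕ} (hl : 0 < l) : (starTree N l i).leaves = l := by
  rw [starTree, leaves_stem _, leaves_legs, List.length_ofFn]
  intro h
  have := congrArg leaves h
  simp [leaves] at this; omega

/-- Here `g = k + 1` and `N = n - g`. For balanced legs the last inequality says that every leg has
at least `g - 1 + i` edges. -/
theorem eq_stem_or_reducible_cyc {t : PlaneTree} {k l N : ℕ} (hk : 1 ≤ k) (hl : 2 ≤ l)
    (hN : t.size = N) (hlv : t.leaves = l) :
    (∃ i L, t = stem i (legs L) ∧ L.Perm (List.ofFn (legLength (N - i - l) l)) ∧ i + l ≤ N ∧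
      (i = 0 ∨ l * (k + i) ≤ N - i)) ∨
    ∃ t' : PlaneTree, t'.size = N ∧ t'.leaves = l ∧
      PosCoeff ((LapPair.cyc k * t.pair).total - (LapPair.cyc k * t'.pair).total) := by
  have red : t.Reducible → ∃ t' : PlaneTree, t'.size = N ∧ t'.leaves = l ∧
      PosCoeff ((LapPair.cyc k * t.pair).total - (LapPair.cyc k * t'.pair).total) := by
    rintro ⟨t', h1, h2, h3⟩
    refine ⟨t', by omega, by omega, ?_⟩
    rw [mul_comm, mul_comm _ t'.pair]
    exact h3.total_mul (LapPair.good_cyc k) (LapPair.pos_diff_cyc hk)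
  rcases exists_stem_legs_or_reducible t with ⟨i, L, rfl⟩ | h
  swap
  · exact .inr (red h)
  have hne : legs L ≠ nil := by
    intro h
    have := leaves_stem_nil i
    rw [h] at hlv; omega
  have hLl : L.length = l := by rw [← hlv, leaves_stem i hne, leaves_legs]
  rw [size_stem, size_legs, hLl] at hN
  by_cases hb : ∀ a ∈ L, ∀ b ∈ L, b ≤ a + 1
  swap
  · obtain ⟨a, b, K, hp, hab⟩ := exists_perm_of_not_balanced hb
    exact .inr (red (reducible_stem (reducible_legs hp hab) i))
  by_cases hi : i = 0 ∨ l * (k + i) ≤ N - i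
  · exact .inl ⟨i, L, rfl, perm_ofFn_legLength (by omega) hLl (by omega) hb, by omega, hi⟩
  right
  push Not at hi
  obtain ⟨i, rfl⟩ := Nat.exists_eq_succ_of_ne_zero hi.1
  -- The legs have fewer than `k + i + 1` edges on average, so some leg has `a + 1 ≤ k + i` edges:
  -- the range in which the cycle with a stem of `i` edges has positive excess.
  obtain ⟨a, ha, hac⟩ : ∃ a ∈ L, a < k + i := by
    apply exists_mem_lt_of_sum_lt
    have := hi.2
    rw [hLl]
    simp only [Nat.succ_eq_add_one] at this
    rw [← add_assoc, mul_add l (k + i) 1] at this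
    omega
  have hp := List.perm_cons_erase ha
  set K := L.erase a
  have hKl := hp.length_eq
  have hKs := hp.sum_eq
  simp only [List.length_cons, List.sum_cons] at hKl hKs
  have hK : legs K ≠ nil := by
    intro h
    have := congrArg leaves h
    simp [leaves] at this
    simp [this] at hKl; omega
  refine ⟨stem i (legs ((a + 1) :: K)), ?_, ?_, ?_⟩
  · simp; omega
  · rw [leaves_stem i (by simp [legs])]; simp; omega
  · rw [pair_stem, pair_stem, pair_legs_perm hp, pair_legs_cons, pair_legs_cons,
      Nat.succ_eq_add_one, Function.iterate_succ_apply, LapPair.total_mul_hang_iterate,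
      LapPair.total_mul_hang_iterate, LapPair.total_hang_leg_mul_sub]
    refine (pos_diff_pair hK).mul (LapPair.pos_excess_hang_iterate (LapPair.good_cyc k)
      (fun m hm => LapPair.pos_excess_cyc hk hm) i (by omega))

end PlaneTree

/-! ### Lowest and leading coefficients: incomparability -/

namespace LapPair

/-- The constant coefficients of the polynomials are one. -/
def Monic₀ (u : LapPair) : Prop := u.total.coeff 0 = 1 ∧ u.ground.coeff 0 = 1

theorem Monic₀.mul {u v : LapPair} (hu : Monic₀ u) (hv : Monic₀ v) : Monic₀ (u * v) :=
  ⟨by simp [total_mul, mul_coeff_zero, hu.1, hu.2, hv.1, hv.2],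
    by simp [mul_coeff_zero, hu.2, hv.2]⟩

theorem Monic₀.hang {u : LapPair} (hu : Monic₀ u) : Monic₀ u.hang :=
  ⟨by simp [total_hang, mul_coeff_zero, hu.1],
    by simp [ground_hang, mul_coeff_zero, hu.1]⟩

/-- The leading coefficients of the polynomials of a rooted tree with `s` edges. -/
structure HasTop (u : LapPair) (s : ℕ) : Prop where
  natDegree_total : u.total.natDegree ≤ s
  natDegree_ground : u.ground.natDegree ≤ s
  coeff_total : u.total.coeff s = s + 1
  coeff_ground : u.ground.coeff s = 1

theorem HasTop.one : HasTop 1 0 := ⟨by simp, by simp, by simp, by simp⟩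

theorem HasTop.mul {u v : LapPair} {s t : ℕ} (hu : HasTop u s) (hv : HasTop v t) :
    HasTop (u * v) (s + t) where
  natDegree_total := by
    rw [total_mul]
    refine (natDegree_sub_le_of_le (m := s + t) (n := s + t)
      (natDegree_add_le_of_degree_le ?_ ?_) ?_).trans (max_self _).le
    · exact natDegree_mul_le_of_le hu.natDegree_total hv.natDegree_ground
    · exact natDegree_mul_le_of_le hu.natDegree_ground hv.natDegree_total
    · exact natDegree_mul_le_of_le hu.natDegree_ground hv.natDegree_ground
  natDegree_ground := natDegree_mul_le_of_le hu.natDegree_ground hv.natDegree_ground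
  coeff_total := by
    rw [total_mul, coeff_sub, coeff_add,
      coeff_mul_add_eq_of_natDegree_le hu.natDegree_total hv.natDegree_ground,
      coeff_mul_add_eq_of_natDegree_le hu.natDegree_ground hv.natDegree_total,
      coeff_mul_add_eq_of_natDegree_le hu.natDegree_ground hv.natDegree_ground,
      hu.coeff_total, hu.coeff_ground, hv.coeff_total, hv.coeff_ground]
    push_cast; ring
  coeff_ground := by
    rw [ground_mul, coeff_mul_add_eq_of_natDegree_le hu.natDegree_ground hv.natDegree_ground,
      hu.coeff_ground, hv.coeff_ground, one_mul]

theorem HasTop.hang {u : LapPair} {s : ℕ} (hu : HasTop u s) : HasTop u.hang (s + 1) := by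
  have h1 : u.total.coeff (s + 1) = 0 :=
    coeff_eq_zero_of_natDegree_lt (Nat.lt_succ_of_le hu.natDegree_total)
  have hX : ∀ p : ℤ[X], p.natDegree ≤ s → ((X : ℤ[X]) * p).natDegree ≤ s + 1 := fun p hp => by
    exact (natDegree_mul_le_of_le natDegree_X_le hp).trans (add_comm 1 s).le
  have e : u.hang.total = u.total + X * u.total + X * u.ground := by rw [total_hang]; ring
  refine ⟨?_, ?_, ?_, ?_⟩
  · rw [e]
    exact natDegree_add_le_of_degree_le (natDegree_add_le_of_degree_le
      (hu.natDegree_total.trans (Nat.le_succ s)) (hX _ hu.natDegree_total)) (hX _ hu.natDegree_ground)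
  · exact natDegree_add_le_of_degree_le (hu.natDegree_total.trans (Nat.le_succ s))
      (hX _ hu.natDegree_ground)
  · rw [e]
    simp [coeff_X_mul, h1, hu.coeff_total, hu.coeff_ground]
  · simp [ground_hang, coeff_X_mul, h1, hu.coeff_ground]

theorem monic₀_leg (m : ℕ) : Monic₀ (leg m) := by
  induction m with
  | zero => exact ⟨by simp, by simp⟩
  | succ m ih => rw [leg_succ]; exact ih.hang

theorem hasTop_leg (m : ℕ) : HasTop (leg m) m := by
  induction m with
  | zero => exact .one
  | succ m ih => rw [leg_succ]; exact ih.hang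

theorem leg_ground_sub_succ (k : ℕ) : (leg (k + 1)).ground - X ^ (k + 1) =
    (leg k).total + X * ((leg k).ground - X ^ k) := by
  rw [leg_ground_succ]; ring

/-- The coefficient is the sum of the top coefficients `j + 1` of the totals of the paths with `j ≤
k` edges; doubling avoids a division. -/
theorem natDegree_leg_ground_sub (k : ℕ) :
    ((leg (k + 1)).ground - X ^ (k + 1)).natDegree ≤ k ∧
      2 * ((leg (k + 1)).ground - X ^ (k + 1)).coeff k = ((k : ℤ) + 1) * (k + 2) := by
  induction k with
  | zero => simp [leg_succ, hang]
  | succ k ih =>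
    rw [leg_ground_sub_succ]
    refine ⟨natDegree_add_le_of_degree_le (hasTop_leg _).natDegree_total ?_, ?_⟩
    · exact (natDegree_mul_le_of_le natDegree_X_le ih.1).trans (add_comm 1 k).le
    · rw [coeff_add, coeff_X_mul, mul_add, ih.2, (hasTop_leg _).coeff_total]
      push_cast; ring

/-- The polynomial `excess (cyc (k + 1)) (m + 1) / X`. -/
theorem excess_cyc_coeff (k m : ℕ) (hkm : k < m) : ∃ E : ℤ[X],
    (cyc (k + 1)).excess (m + 1) = X * E ∧ E.coeff 0 = 1 ∧ E.natDegree ≤ k + m + 1 ∧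
      E.coeff (k + m + 1) < 0 := by
  obtain ⟨h1, h2⟩ := natDegree_leg_ground_sub k
  have ha := hasTop_leg (k + 1)
  have hb := hasTop_leg (m + 1)
  have hc := hasTop_leg m
  refine ⟨_, excess_cyc_succ _ _, ?_, ?_, ?_⟩
  · simp [mul_coeff_zero, (monic₀_leg _).1, (monic₀_leg _).2, coeff_X_pow]
  · refine (natDegree_sub_le_of_le (m := k + m + 1) (n := k + m + 1) ?_ ?_).trans (max_self _).le
    · rw [mul_assoc]
      refine (natDegree_C_mul_le (2 : ℤ) _).trans ?_
      exact (natDegree_mul_le_of_le h1 hb.natDegree_ground).trans (add_assoc k m 1).ge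
    · rw [show k + m + 1 = k + 1 + m by ring]
      exact natDegree_mul_le_of_le ha.natDegree_total hc.natDegree_total
  · have e1 : (2 * ((leg (k + 1)).ground - X ^ (k + 1)) * (leg (m + 1)).ground).coeff (k + m + 1) =
        ((k : ℤ) + 1) * (k + 2) := by
      rw [mul_assoc, show (2 : ℤ[X]) = C 2 from rfl, coeff_C_mul, add_assoc,
        coeff_mul_add_eq_of_natDegree_le h1 hb.natDegree_ground, hb.coeff_ground, mul_one, h2]
    have e2 : ((leg (k + 1)).total * (leg m).total).coeff (k + m + 1) = ((k : ℤ) + 2) * (m + 1) := by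
      rw [show k + m + 1 = k + 1 + m by ring,
        coeff_mul_add_eq_of_natDegree_le ha.natDegree_total hc.natDegree_total,
        ha.coeff_total, hc.coeff_total]
      push_cast; ring
    -- The difference is `(k + 2) * (k - m)`.
    rw [coeff_sub, e1, e2]
    have : (k : ℤ) < m := by exact_mod_cast hkm
    nlinarith

end LapPair

namespace PlaneTree

theorem monic₀_pair : ∀ t : PlaneTree, t.pair.Monic₀
  | nil => ⟨by simp [pair], by simp [pair]⟩
  | cons s t => s.monic₀_pair.hang.mul t.monic₀_pair

theorem hasTop_pair : ∀ t : PlaneTree, t.pair.HasTop t.size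
  | nil => .one
  | cons s t => s.hasTop_pair.hang.mul t.hasTop_pair

theorem coeff_zero_diff (t : PlaneTree) : t.pair.diff.coeff 0 = 0 := by
  simp [LapPair.diff, t.monic₀_pair.1, t.monic₀_pair.2]

theorem coeff_one_diff {t : PlaneTree} (h : t ≠ nil) : 0 < t.pair.diff.coeff 1 := by
  cases t with
  | nil => exact absurd rfl h
  | cons s t =>
    rw [pair, LapPair.diff_mul, LapPair.diff_hang, coeff_add, mul_coeff_one,
      mul_coeff_one (s.pair.hang.ground), coeff_zero_diff]
    have := t.good_pair.diff 1
    simp [mul_coeff_zero, s.monic₀_pair.hang.2, s.monic₀_pair.1, t.monic₀_pair.2]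
    omega

theorem diff_top (t : PlaneTree) :
    t.pair.diff.natDegree ≤ t.size ∧ t.pair.diff.coeff t.size = t.size := by
  have h := t.hasTop_pair
  exact ⟨(natDegree_sub_le_of_le h.natDegree_total h.natDegree_ground).trans (max_self _).le,
    by simp [LapPair.diff, h.coeff_total, h.coeff_ground]⟩

/-- The two trees share the legs `K`, so the difference is `X ^ (2 * i + 1)` times the `diff` of
these legs, which begins in degree one, times the polynomial of `excess_cyc_coeff`. Here `g = k +
2`, so `N + k` is `n - 2`. -/
theorem starTree_succ_sub {N l k i : ℕ} (hl : 2 ≤ l)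
    (h : l * (k + 2 + i) ≤ N - (i + 1)) :
    let f := (LapPair.cyc (k + 1) * (starTree N l (i + 1)).pair).total -
      (LapPair.cyc (k + 1) * (starTree N l i).pair).total
    (∀ j < 2 * i + 2, f.coeff j = 0) ∧ 0 < f.coeff (2 * i + 2) ∧ f.coeff (N + k) < 0 := by
  intro f
  have hlN : l + i + 1 ≤ N := by
    have : l * 1 ≤ l * (k + 2 + i) := Nat.mul_le_mul_left _ (by omega)
    have : 0 < l * (k + 2 + i) := Nat.mul_pos (by omega) (by omega)
    omega
  obtain ⟨K, hK1, hK2⟩ := exists_perm_legLength_succ (N - (i + 1) - l) l (by omega)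
  rw [show N - (i + 1) - l + 1 = N - i - l by omega] at hK2
  set a := (N - (i + 1) - l) / l with ha
  have ha' : k + 1 + i ≤ a := by
    rw [ha, Nat.le_div_iff_mul_le (by omega)]
    have : l * (k + 2 + i) = (k + 1 + i) * l + l := by ring
    omega
  have hlen := hK1.length_eq
  have hsum := hK1.sum_eq
  rw [sum_ofFn_legLength _ l (by omega)] at hsum
  simp only [List.length_cons, List.sum_cons, List.length_ofFn] at hlen hsum
  obtain ⟨m, hm⟩ := Nat.exists_eq_add_of_le (show i ≤ a by omega)
  obtain ⟨E, hE, hE0, hEd, hEc⟩ := LapPair.excess_cyc_coeff k m (by omega)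
  have hf : f = X ^ (2 * i + 1) * ((legs K).pair.diff * E) := by
    simp only [f, starTree]
    rw [pair_stem, pair_stem, pair_legs_perm hK1, pair_legs_perm hK2, pair_legs_cons,
      pair_legs_cons, Function.iterate_succ_apply, LapPair.total_mul_hang_iterate,
      LapPair.total_mul_hang_iterate, LapPair.total_hang_leg_mul_sub, hm, add_assoc i m 1,
      LapPair.excess_hang_iterate, hE]
    ring
  have hKne : legs K ≠ nil := by
    intro h
    have := congrArg leaves h
    simp [leaves] at this
    simp [this] at hlen; omega
  have hsz : (legs K).size = K.sum + K.length := size_legs K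
  have hc0 : ((legs K).pair.diff * E).coeff 0 = 0 := by simp [mul_coeff_zero, coeff_zero_diff]
  refine ⟨fun j hj => ?_, ?_, ?_⟩
  · rw [hf, coeff_X_pow_mul']
    split_ifs with h'
    · rw [show j - (2 * i + 1) = 0 by omega, hc0]
    · rfl
  · rw [hf, show 2 * i + 2 = 1 + (2 * i + 1) by ring, coeff_X_pow_mul, mul_coeff_one,
      coeff_zero_diff, hE0]
    simpa using coeff_one_diff hKne
  · obtain ⟨d1, d2⟩ := diff_top (legs K)
    rw [hf, show N + k = (legs K).size + (k + m + 1) + (2 * i + 1) by omega, coeff_X_pow_mul,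
      coeff_mul_add_eq_of_natDegree_le d1 hEd, d2]
    refine mul_neg_of_pos_of_neg ?_ hEc
    have : 0 < (legs K).size := by omega
    exact_mod_cast this

/-- Telescoping: steps after the first leave the coefficient `2 * i + 2` alone, while every step
lowers the coefficient `N + k`. -/
theorem starTree_incomparable {N l k p : ℕ} (hl : 2 ≤ l)
    (h : ∀ i, 1 ≤ i → i ≤ p → l * (k + 1 + i) ≤ N - i) {i j : ℕ} (hij : i < j) (hj : j ≤ p) :
    let T := fun i => (LapPair.cyc (k + 1) * (starTree N l i).pair).total
    (T i).coeff (2 * i + 2) < (T j).coeff (2 * i + 2) ∧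
      (T j).coeff (N + k) < (T i).coeff (N + k) := by
  intro T
  induction j, hij using Nat.le_induction with
  | base =>
    have := starTree_succ_sub (N := N) (k := k) (i := i) hl (by
      have := h (i + 1) (by omega) hj
      rwa [show k + 2 + i = k + 1 + (i + 1) by ring])
    simp only [coeff_sub] at this
    exact ⟨by simpa [T] using this.2.1, by simpa [T] using this.2.2⟩
  | succ j hij ih =>
    have := starTree_succ_sub (N := N) (k := k) (i := j) hl (by
      have := h (j + 1) (by omega) hj
      rwa [show k + 2 + j = k + 1 + (j + 1) by ring])
    simp only [coeff_sub] at this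
    obtain ⟨h1, h2⟩ := ih (by omega)
    have h3 := this.1 (2 * i + 2) (by omega)
    have h4 := this.2.2
    simp only [T] at *
    omega

end PlaneTree

/-! ### Determinants of matrices joined by an edge -/

namespace Matrix

variable {V W R : Type*} [Fintype V] [Fintype W] [DecidableEq V] [DecidableEq W] [CommRing R]

/-- The block matrix of two matrices joined by an edge of weight `x`. -/
def joinAt (M : Matrix V V R) (a : V) (N : Matrix W W R) (b : W) (x : R) :
    Matrix (V ⊕ W) (V ⊕ W) R :=
  fromBlocks (M.updateRow a (M a + x • Pi.single a 1)) (-(x • single a b 1))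
    (-(x • single b a 1)) (N.updateRow b (N b + x • Pi.single b 1))

theorem det_updateRow_add_smul_single (M : Matrix V V R) (a : V) (x : R) :
    (M.updateRow a (M a + x • Pi.single a 1)).det =
      M.det + x * (M.updateRow a (Pi.single a 1)).det := by
  rw [det_updateRow_add, det_updateRow_smul, updateRow_eq_self]

theorem det_joinAt_updateRow_inr (M : Matrix V V R) (a : V) (N : Matrix W W R) (b : W) (x : R)
    (v : W → R) : ((M.joinAt a N b x).updateRow (.inr b) (Sum.elim 0 v)).det =
      (M.det + x * (M.updateRow a (Pi.single a 1)).det) * (N.updateRow b v).det := by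
  have h : (M.joinAt a N b x).updateRow (.inr b) (Sum.elim 0 v) =
      fromBlocks (M.updateRow a (M a + x • Pi.single a 1)) (-(x • single a b 1)) 0
        (N.updateRow b v) := by
    ext i j
    rcases i with i | i <;> rcases j with j | j <;>
      simp [joinAt, updateRow_apply, single_apply] <;> grind
  rw [h, det_fromBlocks_zero₂₁, det_updateRow_add_smul_single]

theorem det_joinAt_updateRow_inl (M : Matrix V V R) (a : V) (N : Matrix W W R) (b : W) (x : R)
    (w : V → R) : ((M.joinAt a N b x).updateRow (.inr b) (Sum.elim w 0)).det =
      x * (M.updateRow a w).det * (N.updateRow b (Pi.single b 1)).det := by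
  set K := (M.joinAt a N b x).updateRow (.inr b) (Sum.elim w 0) with hK
  have hrow : K (.inl a) = (Sum.elim (M a + x • Pi.single a 1) 0 : V ⊕ W → R) +
      (-x) • (Sum.elim 0 (Pi.single b 1) : V ⊕ W → R) := by
    ext j
    rcases j with j | j
    · simp [hK, joinAt]
    · simp [hK, joinAt, single_apply, Pi.single_apply, eq_comm]
  -- Keeping the part of row `a` on `V` gives a block triangular matrix whose `W` block has a zero
  -- row.
  have h1 : (K.updateRow (.inl a) (Sum.elim (M a + x • Pi.single a 1) 0)).det = 0 := by
    have h : K.updateRow (.inl a) (Sum.elim (M a + x • Pi.single a 1) 0) =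
        fromBlocks (M.updateRow a (M a + x • Pi.single a 1)) 0
          ((-(x • single b a 1) : Matrix W V R).updateRow b w) (N.updateRow b 0) := by
      ext i j
      rcases i with i | i <;> rcases j with j | j <;>
        simp [hK, joinAt, updateRow_apply, single_apply] <;> grind
    rw [h, det_fromBlocks_zero₁₂, det_eq_zero_of_row_eq_zero (A := N.updateRow b 0) b (by simp),
      mul_zero]
  -- For the part of row `a` on `W`, exchanging rows `a` and `b` gives a block diagonal matrix,
  -- whence the sign.
  have h2 : (K.updateRow (.inl a) (Sum.elim (0 : V → R) (Pi.single b (1 : R)))).det =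
      -((M.updateRow a w).det * (N.updateRow b (Pi.single b 1)).det) := by
    have h : (K.updateRow (.inl a) (Sum.elim (0 : V → R) (Pi.single b (1 : R)))).submatrix
        (Equiv.swap (.inl a) (.inr b)) id =
        fromBlocks (M.updateRow a w) 0 0 (N.updateRow b (Pi.single b 1)) := by
      ext i j
      rcases i with i | i
      · by_cases hi : i = a
        · subst hi
          rcases j with j | j <;> simp [hK, updateRow_apply]
        · rw [submatrix_apply, Equiv.swap_apply_of_ne_of_ne (by simpa using hi) (by simp)]
          rcases j with j | j <;> simp [hK, joinAt, updateRow_apply, hi, Ne.symm hi]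
      · by_cases hi : i = b
        · subst hi
          rcases j with j | j <;> simp [updateRow_apply, Pi.single_apply]
        · rw [submatrix_apply, Equiv.swap_apply_of_ne_of_ne (by simp) (by simpa using hi)]
          rcases j with j | j <;> simp [hK, joinAt, updateRow_apply, hi, Ne.symm hi]
    have h' := congrArg det h
    rw [det_permute, Equiv.Perm.sign_swap (by simp), det_fromBlocks_zero₂₁] at h'
    rw [← h']; simp
  rw [← updateRow_eq_self K (.inl a), hrow, det_updateRow_add, det_updateRow_smul, h1, h2]
  ring

theorem det_joinAt (M : Matrix V V R) (a : V) (N : Matrix W W R) (b : W) (x : R) :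
    (M.joinAt a N b x).det = M.det * N.det + x * (M.det * (N.updateRow b (Pi.single b 1)).det +
      (M.updateRow a (Pi.single a 1)).det * N.det) := by
  have h : (M.joinAt a N b x) (.inr b) = (Sum.elim 0 (N b + x • Pi.single b 1) : V ⊕ W → R) +
      (-x) • (Sum.elim (Pi.single a 1) 0 : V ⊕ W → R) := by
    ext j
    rcases j with j | j
    · simp [joinAt, single_apply, Pi.single_apply, eq_comm]
    · simp [joinAt]
  rw [← updateRow_eq_self (M.joinAt a N b x) (.inr b), h, det_updateRow_add, det_updateRow_smul,
    det_joinAt_updateRow_inl, det_joinAt_updateRow_inr, det_updateRow_add_smul_single]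
  ring

theorem det_joinAt_updateRow_root (M : Matrix V V R) (a : V) (N : Matrix W W R) (b : W) (x : R) :
    ((M.joinAt a N b x).updateRow (.inr b) (Pi.single (.inr b) 1)).det =
      (M.det + x * (M.updateRow a (Pi.single a 1)).det) * (N.updateRow b (Pi.single b 1)).det := by
  rw [← det_joinAt_updateRow_inr]
  congr 2
  ext j
  rcases j with j | j <;> simp [Pi.single_apply]

theorem det_updateRow_submatrix (e : V ≃ W) (M : Matrix W W R) (a : V) (r : W → R) :
    ((M.submatrix e e).updateRow a (r ∘ e)).det = (M.updateRow (e a) r).det := by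
  rw [← det_submatrix_equiv_self e (M.updateRow (e a) r)]
  congr 1
  ext i j
  simp [updateRow_apply]

/-- The pair of a matrix of polynomials with a distinguished index. -/
def lapPair (M : Matrix V V ℤ[X]) (a : V) : LapPair :=
  ⟨M.det, (M.updateRow a (Pi.single a 1)).det⟩

theorem lapPair_submatrix (e : V ≃ W) (M : Matrix W W ℤ[X]) (a : V) :
    (M.submatrix e e).lapPair a = M.lapPair (e a) := by
  have h : (Pi.single a 1 : V → ℤ[X]) = (Pi.single (e a) 1 : W → ℤ[X]) ∘ e := by
    ext j; simp [Pi.single_apply]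
  simp only [lapPair, h, det_updateRow_submatrix, det_submatrix_equiv_self]

theorem lapPair_joinAt (M : Matrix V V ℤ[X]) (a : V) (N : Matrix W W ℤ[X]) (b : W) :
    (M.joinAt a N b X).lapPair (.inr b) = (M.lapPair a).hang * N.lapPair b := by
  ext1
  · simp only [lapPair, det_joinAt, LapPair.total_mul, LapPair.hang]; ring
  · simp only [lapPair, det_joinAt_updateRow_root, LapPair.ground_mul, LapPair.hang]

theorem lapPair_of_unique [Unique V] (M : Matrix V V ℤ[X]) (a : V) :
    M.lapPair a = ⟨M a a, 1⟩ := by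
  simp [lapPair, det_unique, Subsingleton.elim a default]

/-! ### The matrix of a path -/

/-- The matrix of a path, with an additional weight at the last vertex. -/
def pathMatrix (k : ℕ) (c : ℤ[X]) : Matrix (Fin (k + 1)) (Fin (k + 1)) ℤ[X] := fun i j =>
  if i = j then 1 + (if i = 0 then 0 else X) + (if i = Fin.last k then c else X)
  else if i.val + 1 = j.val ∨ j.val + 1 = i.val then -X else 0

/-- The new vertex is the first one. -/
def finSuccSum (k : ℕ) : Fin (k + 1) ⊕ Unit ≃ Fin (k + 2) where
  toFun := Sum.elim Fin.succ fun _ => 0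
  invFun := Fin.cases (.inr ()) .inl
  left_inv := by rintro (i | i) <;> simp
  right_inv := by intro i; refine Fin.cases ?_ (fun i => ?_) i <;> simp

theorem pathMatrix_succ (k : ℕ) (c : ℤ[X]) :
    (pathMatrix (k + 1) c).submatrix (finSuccSum k) (finSuccSum k) =
      (pathMatrix k c).joinAt 0 (1 : Matrix Unit Unit ℤ[X]) () X := by
  ext1 i j
  rcases i with i | i <;> rcases j with j | j
  · simp only [submatrix_apply, finSuccSum, Equiv.coe_fn_mk, Sum.elim_inl, joinAt,
      fromBlocks_apply₁₁, updateRow_apply, pathMatrix, Fin.val_succ, Fin.ext_iff,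
      Fin.val_last, Pi.add_apply, Pi.smul_apply, Pi.single_apply, smul_eq_mul, Fin.val_zero]
    grind
  · simp only [submatrix_apply, finSuccSum, Equiv.coe_fn_mk, Sum.elim_inl, Sum.elim_inr, joinAt,
      fromBlocks_apply₁₂, pathMatrix, Fin.val_succ, Fin.ext_iff, single_apply, neg_apply,
      smul_apply, Fin.val_zero, smul_eq_mul]
    split_ifs <;> first | omega | simp_all
  · simp only [submatrix_apply, finSuccSum, Equiv.coe_fn_mk, Sum.elim_inl, Sum.elim_inr, joinAt,
      fromBlocks_apply₂₁, pathMatrix, Fin.val_succ, Fin.ext_iff, single_apply, neg_apply,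
      smul_apply, Fin.val_zero, smul_eq_mul]
    split_ifs <;> first | omega | simp_all
  · simp [finSuccSum, joinAt, pathMatrix, Fin.ext_iff]

theorem lapPair_pathMatrix (k : ℕ) (c : ℤ[X]) :
    (pathMatrix k c).lapPair 0 = LapPair.hang^[k] ⟨1 + c, 1⟩ := by
  induction k with
  | zero =>
    have : Unique (Fin (0 + 1)) := inferInstanceAs (Unique (Fin 1))
    rw [lapPair_of_unique]; simp [pathMatrix]
  | succ k ih =>
    have h : (0 : Fin (k + 2)) = finSuccSum k (.inr ()) := rfl
    rw [h, ← lapPair_submatrix, pathMatrix_succ, lapPair_joinAt, ih, Function.iterate_succ_apply',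
      lapPair_of_unique]
    simp only [one_apply_eq]
    exact mul_one _

/-- A corner cofactor: only the product of the off-diagonal entries along the path survives. -/
theorem det_pathMatrix_updateRow (k : ℕ) (c : ℤ[X]) :
    ((pathMatrix k c).updateRow 0 (Pi.single (Fin.last k) 1)).det = X ^ k := by
  induction k with
  | zero => simp
  | succ k ih =>
    have h : (0 : Fin (k + 2)) = finSuccSum k (.inr ()) := rfl
    have h' : (Pi.single (Fin.last (k + 1)) 1 : Fin (k + 2) → ℤ[X]) ∘ finSuccSum k =
        Sum.elim (Pi.single (Fin.last k) 1) 0 := by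
      ext1 j
      rcases j with j | j
      · simp [finSuccSum, Pi.single_apply, Fin.ext_iff]
      · simp [finSuccSum, Fin.ext_iff]
    rw [h, ← det_updateRow_submatrix, pathMatrix_succ, h', det_joinAt_updateRow_inl, ih]
    simp
    ring

end Matrix

/-! ### From the path to the cycle -/

namespace LapPair

/-- A weight `X` at the last vertex is an edge to a grounded vertex, so the first component belongs
to a path with one more edge, grounded at its far end. -/
theorem hang_iterate_one_add_X (k : ℕ) :
    hang^[k] ⟨1 + X, 1⟩ = ⟨(leg (k + 1)).ground, (leg k).total⟩ := by
  induction k with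
  | zero => simp [leg_succ, hang]
  | succ k ih =>
    rw [Function.iterate_succ_apply', ih]
    ext1 <;> simp only [leg_succ, hang] <;> ring

end LapPair

namespace Matrix

theorem pathMatrix_isSymm (k : ℕ) (c : ℤ[X]) : (pathMatrix k c).transpose = pathMatrix k c := by
  ext1 i j
  simp only [transpose_apply, pathMatrix, Fin.ext_iff]
  split_ifs <;> first | omega | rfl

/-- The matrix of a cycle. -/
def cycleMatrix (k : ℕ) : Matrix (Fin (k + 1)) (Fin (k + 1)) ℤ[X] :=
  ((pathMatrix k 0).updateRow 0
    (pathMatrix k 0 0 + (X : ℤ[X]) • (Pi.single 0 1 - Pi.single (Fin.last k) 1 :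
      Fin (k + 1) → ℤ[X]))).updateRow (Fin.last k)
    (pathMatrix k 0 (Fin.last k) - (X : ℤ[X]) • (Pi.single 0 1 - Pi.single (Fin.last k) 1 :
      Fin (k + 1) → ℤ[X]))

theorem pathMatrix_X (k : ℕ) : pathMatrix k X = (pathMatrix k 0).updateRow (Fin.last k)
    (pathMatrix k 0 (Fin.last k) + X • Pi.single (Fin.last k) 1) := by
  ext1 i j
  simp only [updateRow_apply, pathMatrix, Pi.add_apply, Pi.smul_apply, Pi.single_apply, smul_eq_mul,
    Fin.ext_iff, Fin.val_last, Fin.val_zero]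
  split_ifs <;> first | omega | ring1

/-- Closing the path adds `X v vᵀ` with `v = e - f`, so the determinant grows by `X vᵀ adj(P) v`.
The adjugate has `b_k` at both diagonal corners and `X ^ k` at the other two. -/
theorem lapPair_cycleMatrix {k : ℕ} (hk : 1 ≤ k) :
    (cycleMatrix k).lapPair 0 = LapPair.cyc k := by
  have hne : (0 : Fin (k + 1)) ≠ Fin.last k := by
    rw [Ne, Fin.ext_iff]; simp; omega
  have hA := lapPair_pathMatrix k 0
  have hX := lapPair_pathMatrix k X
  rw [LapPair.hang_iterate_one_add_X] at hX
  have h1 : LapPair.hang^[k] ⟨1 + 0, 1⟩ = LapPair.leg k := by rw [add_zero]; rfl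
  rw [h1] at hA
  have hA1 : (pathMatrix k 0).det = (LapPair.leg k).total := congrArg LapPair.total hA
  have hA2 : ((pathMatrix k 0).updateRow 0 (Pi.single 0 1)).det = (LapPair.leg k).ground :=
    congrArg LapPair.ground hA
  have hX1 : (pathMatrix k X).det = (LapPair.leg (k + 1)).ground := congrArg LapPair.total hX
  have hX2 : ((pathMatrix k X).updateRow 0 (Pi.single 0 1)).det = (LapPair.leg k).total :=
    congrArg LapPair.ground hX
  have hJ := det_pathMatrix_updateRow k 0
  have hJ' : ((pathMatrix k 0).updateRow (Fin.last k) (Pi.single 0 1)).det = X ^ k := by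
    rw [← hJ, ← adjugate_apply, ← adjugate_apply]
    conv_rhs => rw [← pathMatrix_isSymm, ← adjugate_transpose, transpose_apply]
  set P := pathMatrix k 0 with hP
  set e : Fin (k + 1) → ℤ[X] := Pi.single 0 1
  set f : Fin (k + 1) → ℤ[X] := Pi.single (Fin.last k) 1
  -- The corner at the far end is found, up to the factor `X`, by comparing two expressions for
  -- `b_{k+1}`.
  have hF : (X : ℤ[X]) * (P.updateRow (Fin.last k) f).det = X * (LapPair.leg k).ground := by
    rw [pathMatrix_X, det_updateRow_add, det_updateRow_smul, updateRow_eq_self, hA1,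
      LapPair.leg_ground_succ] at hX1
    exact add_left_cancel hX1
  ext1
  · have c1 : cycleMatrix k = (P.updateRow 0 (P 0 + (X : ℤ[X]) • (e - f))).updateRow (Fin.last k)
        (P (Fin.last k) + (-X : ℤ[X]) • (e - f)) := by
      rw [cycleMatrix, neg_smul, ← sub_eq_add_neg]
    -- The rank-one update contributes no quadratic term.
    have z : ((P.updateRow 0 (e - f)).updateRow (Fin.last k) (e - f)).det = 0 := by
      refine det_zero_of_row_eq hne ?_
      rw [updateRow_self, updateRow_ne hne, updateRow_self]
    have q1 : (P.updateRow 0 (e - f)).det = (LapPair.leg k).ground - X ^ k := by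
      rw [sub_eq_add_neg, det_updateRow_add, ← neg_one_smul ℤ[X] f, det_updateRow_smul, hA2, hJ]
      ring
    have q2 : (X : ℤ[X]) * (P.updateRow (Fin.last k) (e - f)).det =
        X * X ^ k - X * (LapPair.leg k).ground := by
      rw [sub_eq_add_neg, det_updateRow_add, ← neg_one_smul ℤ[X] f, det_updateRow_smul, hJ',
        mul_add, mul_left_comm, hF]
      ring
    have r1 : ((P.updateRow 0 (P 0 + (X : ℤ[X]) • (e - f))).updateRow (Fin.last k) (P (Fin.last k))) =
        P.updateRow 0 (P 0 + (X : ℤ[X]) • (e - f)) := by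
      conv_rhs => rw [← updateRow_eq_self (P.updateRow 0 (P 0 + (X : ℤ[X]) • (e - f))) (Fin.last k),
        updateRow_ne hne.symm]
    have r2 : ((P.updateRow 0 (P 0 + (X : ℤ[X]) • (e - f))).updateRow (Fin.last k) (e - f)).det =
        (P.updateRow (Fin.last k) (e - f)).det := by
      rw [updateRow_comm _ hne, det_updateRow_add, det_updateRow_smul, updateRow_comm _ hne.symm,
        updateRow_comm _ hne.symm, z, updateRow_eq_self]
      ring
    change (cycleMatrix k).det = _
    rw [c1, det_updateRow_add, det_updateRow_smul, r1, r2, det_updateRow_add, det_updateRow_smul,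
      updateRow_eq_self, hA1, q1]
    simp only [LapPair.cyc]
    linear_combination -q2
  -- Once row `0` is grounded, the remaining off-diagonal entry of the closing edge comes from a row
  -- operation, which leaves the determinant of the weighted path.
  · have c2 : (cycleMatrix k).updateRow 0 e = ((pathMatrix k X).updateRow 0 e).updateRow
        (Fin.last k) (((pathMatrix k X).updateRow 0 e) (Fin.last k) +
          (-X : ℤ[X]) • ((pathMatrix k X).updateRow 0 e) 0) := by
      rw [updateRow_self, updateRow_ne hne.symm, pathMatrix_X, updateRow_self, cycleMatrix]
      ext1 i j
      by_cases h0 : i = 0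
      · subst h0; simp [updateRow_apply, hne]
      · by_cases hl : i = Fin.last k
        · subst hl; simp [updateRow_apply, h0, e]; ring
        · simp [updateRow_apply, h0, hl]
    change ((cycleMatrix k).updateRow 0 e).det = _
    rw [c2, det_updateRow_add_smul_self _ hne.symm, hX2]
    rfl

end Matrix

/-! ### The matrix `1 + X L` of a graph -/

namespace SimpleGraph

section
variable {V W : Type*} [Fintype V] [Fintype W]

open Classical in
/-- The matrix `1 + X L(G)`. -/
def lapMat (G : SimpleGraph V) : Matrix V V ℤ[X] := 1 + (X : ℤ[X]) • (G.lapMatrix ℤ).map C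

open Classical in
theorem lapMat_apply (G : SimpleGraph V) (i j : V) : G.lapMat i j =
    if i = j then 1 + X * ∑ k, (if G.Adj i k then 1 else 0) else if G.Adj i j then -X else 0 := by
  simp only [lapMat, Matrix.add_apply, Matrix.smul_apply, Matrix.map_apply, lapMatrix,
    Matrix.sub_apply, degMatrix, adjMatrix_apply, smul_eq_mul, Matrix.one_apply, Matrix.diagonal_apply]
  split_ifs with h h' h'
  · subst h; exact absurd h' (G.irrefl)
  · rw [degree_eq_sum_if_adj]; simp
  · simp
  · simp

theorem det_lapMat_eq (G : SimpleGraph V) [DecidableEq V] [DecidableRel G.Adj] :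
    G.lapMat.det = (G.lapMatrix ℤ).charpolyRev.comp (-X) := by
  rw [Matrix.charpolyRev, ← coe_compRingHom_apply, RingHom.map_det]
  congr 1
  have h : (1 : Matrix V V ℤ[X]) + (X : ℤ[X]) • (G.lapMatrix ℤ).map C = G.lapMat := by
    unfold lapMat; congr!
  rw [← h]
  ext1 i j
  simp only [RingHom.mapMatrix_apply, Matrix.map_apply, Matrix.sub_apply, Matrix.add_apply,
    Matrix.smul_apply, Matrix.one_apply, smul_eq_mul, map_sub, map_mul, coe_compRingHom_apply,
    X_comp, C_comp]
  split_ifs <;> simp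

/-- The Laplacian coefficients are the coefficients of `det (1 + X L)`. -/
theorem lapCoeff_eq_coeff (G : SimpleGraph V) [DecidableEq V] {k : ℕ} (hk : k ≤ Fintype.card V) :
    lapCoeff G k = G.lapMat.det.coeff k := by
  classical
  rw [det_lapMat_eq, show (-X : ℤ[X]) = C (-1) * X by simp, comp_C_mul_X_coeff,
    ← Matrix.reverse_charpoly, reverse, coeff_reflect,
    Matrix.charpoly_natDegree_eq_dim, revAt_le hk, lapCoeff, mul_comm]
  congr!

theorem coeff_det_lapMat_eq_zero (G : SimpleGraph V) [DecidableEq V] {k : ℕ}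
    (hk : Fintype.card V < k) : G.lapMat.det.coeff k = 0 := by
  classical
  rw [det_lapMat_eq, show (-X : ℤ[X]) = C (-1) * X by simp, comp_C_mul_X_coeff,
    ← Matrix.reverse_charpoly]
  rw [coeff_eq_zero_of_natDegree_lt, zero_mul]
  refine (reverse_natDegree_le _).trans_lt ?_
  rwa [Matrix.charpoly_natDegree_eq_dim]

theorem lapMat_iso {G : SimpleGraph V} {H : SimpleGraph W} (e : G ≃g H) :
    G.lapMat = H.lapMat.submatrix e.toEquiv e.toEquiv := by
  classical
  ext1 i j
  simp only [Matrix.submatrix_apply, lapMat_apply, RelIso.coe_fn_toEquiv, e.injective.eq_iff,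
    e.map_adj_iff]
  rw [← e.toEquiv.sum_comp]
  simp [e.map_adj_iff]

theorem det_lapMat_iso {G : SimpleGraph V} {H : SimpleGraph W} [DecidableEq V] [DecidableEq W]
    (e : G ≃g H) : G.lapMat.det = H.lapMat.det := by
  rw [lapMat_iso e, Matrix.det_submatrix_equiv_self]

end

/-- Two graphs joined by an edge. -/
def joinEdge {V W : Type*} (G : SimpleGraph V) (a : V) (H : SimpleGraph W) (b : W) :
    SimpleGraph (V ⊕ W) := (G ⊕g H) ⊔ edge (.inl a) (.inr b)

section
variable {V W : Type*} (G : SimpleGraph V) (a : V) (H : SimpleGraph W) (b : W)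

@[simp] theorem joinEdge_adj_inl {v w : V} : (G.joinEdge a H b).Adj (.inl v) (.inl w) ↔ G.Adj v w := by
  simp [joinEdge, edge_adj]

@[simp] theorem joinEdge_adj_inr {v w : W} : (G.joinEdge a H b).Adj (.inr v) (.inr w) ↔ H.Adj v w := by
  simp [joinEdge, edge_adj]

@[simp] theorem joinEdge_adj_inl_inr {v : V} {w : W} :
    (G.joinEdge a H b).Adj (.inl v) (.inr w) ↔ v = a ∧ w = b := by
  simp [joinEdge, edge_adj]

@[simp] theorem joinEdge_adj_inr_inl {v : V} {w : W} :
    (G.joinEdge a H b).Adj (.inr w) (.inl v) ↔ v = a ∧ w = b := by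
  rw [adj_comm, joinEdge_adj_inl_inr]

theorem lapMat_joinEdge [Fintype V] [Fintype W] [DecidableEq V] [DecidableEq W] :
    (G.joinEdge a H b).lapMat = G.lapMat.joinAt a H.lapMat b X := by
  classical
  ext1 i j
  rcases i with i | i <;> rcases j with j | j
  · simp only [lapMat_apply, Matrix.joinAt, Matrix.fromBlocks_apply₁₁, Matrix.updateRow_apply,
      Pi.add_apply, Pi.smul_apply, Pi.single_apply, smul_eq_mul, Sum.inl.injEq,
      Fintype.sum_sum_type, joinEdge_adj_inl, joinEdge_adj_inl_inr]
    by_cases hi : i = a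
    · subst hi; by_cases hj : i = j <;> simp [hj, eq_comm]; ring
    · simp [hi]
  · simp [lapMat_apply, Matrix.joinAt, Matrix.single_apply, eq_comm]
    split_ifs <;> simp
  · simp [lapMat_apply, Matrix.joinAt, Matrix.single_apply, eq_comm, and_comm]
    split_ifs <;> simp
  · simp only [lapMat_apply, Matrix.joinAt, Matrix.fromBlocks_apply₂₂, Matrix.updateRow_apply,
      Pi.add_apply, Pi.smul_apply, Pi.single_apply, smul_eq_mul, Sum.inr.injEq,
      Fintype.sum_sum_type, joinEdge_adj_inr, joinEdge_adj_inr_inl]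
    by_cases hi : i = b
    · subst hi; by_cases hj : i = j <;> simp [hj, eq_comm]; ring
    · simp [hi]

theorem lapMat_cycleGraph (k : ℕ) : (cycleGraph (k + 3)).lapMat = Matrix.cycleMatrix (k + 2) := by
  classical
  have hdeg : ∀ i : Fin (k + 3), ∑ j,
      (@ite _ ((cycleGraph (k + 3)).Adj i j) (Classical.propDecidable _) 1 0 : ℤ[X]) = 2 := fun i => by
    have := degree_eq_sum_if_adj (G := cycleGraph (k + 3)) (R := ℤ[X]) i
    rw [cycleGraph_degree_three_le] at this
    rw [show (2 : ℤ[X]) = ((2 : ℕ) : ℤ[X]) from rfl, this]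
    congr!
  have hadj : ∀ i j : Fin (k + 3), (cycleGraph (k + 3)).Adj i j ↔
      (i.val + 1 = j.val ∨ j.val + 1 = i.val) ∨ (i.val = 0 ∧ j.val = k + 2) ∨
        (j.val = 0 ∧ i.val = k + 2) := by
    intro i j
    have hi := i.isLt
    have hj := j.isLt
    rcases lt_trichotomy i j with h | rfl | h
    · rw [cycleGraph_adj', Fin.coe_sub_iff_lt.2 h, Fin.sub_val_of_le h.le]
      rw [Fin.lt_def] at h; omega
    · simp only [SimpleGraph.irrefl, false_iff]; omega
    · rw [cycleGraph_adj', Fin.coe_sub_iff_lt.2 h, Fin.sub_val_of_le h.le]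
      rw [Fin.lt_def] at h; omega
  ext1 i j
  simp only [lapMat_apply, hdeg]
  simp only [hadj, Matrix.cycleMatrix, Matrix.pathMatrix, Matrix.updateRow_apply, Pi.add_apply, Pi.sub_apply, Pi.smul_apply,
    Pi.single_apply, smul_eq_mul, Fin.ext_iff, Fin.val_last, Fin.val_zero]
  grind

end

end SimpleGraph

/-! ### Rooted isomorphisms and leaves of joined graphs -/

namespace SimpleGraph

theorem lapPair_lapMat_of_unique {V : Type*} [Fintype V] [DecidableEq V] [Unique V]
    (G : SimpleGraph V) (a : V) : G.lapMat.lapPair a = 1 := by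
  rw [Matrix.lapPair_of_unique, lapMat_apply]
  have : ∀ k, ¬ G.Adj a k := fun k h => h.ne (Subsingleton.elim _ _)
  simp [this]
  rfl

/-- An isomorphism of graphs compatible with chosen vertices. -/
def RootedIso {V W : Type*} (G : SimpleGraph V) (a : V) (H : SimpleGraph W) (b : W) : Prop :=
  ∃ e : G ≃g H, e a = b

namespace RootedIso
variable {V W U : Type*} {G : SimpleGraph V} {a : V} {H : SimpleGraph W} {b : W}
  {K : SimpleGraph U} {c : U}

theorem refl : RootedIso G a G a := ⟨Iso.refl, rfl⟩

theorem symm (h : RootedIso G a H b) : RootedIso H b G a := by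
  obtain ⟨e, rfl⟩ := h
  exact ⟨e.symm, by simp⟩

theorem trans (h : RootedIso G a H b) (h' : RootedIso H b K c) : RootedIso G a K c := by
  obtain ⟨e, rfl⟩ := h
  obtain ⟨f, rfl⟩ := h'
  exact ⟨e.trans f, rfl⟩

theorem joinEdge {V' W' : Type*} {G' : SimpleGraph V'} {a' : V'} {H' : SimpleGraph W'} {b' : W'}
    (h : RootedIso G a G' a') (h' : RootedIso H b H' b') :
    RootedIso (G.joinEdge a H b) (.inr b) (G'.joinEdge a' H' b') (.inr b') := by
  obtain ⟨e, rfl⟩ := h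
  obtain ⟨f, rfl⟩ := h'
  refine ⟨⟨Equiv.sumCongr e.toEquiv f.toEquiv, ?_⟩, rfl⟩
  rintro (x | x) (y | y) <;> simp [e.map_adj_iff, f.map_adj_iff]

theorem joinEdge_swap : RootedIso (G.joinEdge a (H.joinEdge b K c) (.inr c)) (.inr (.inr c))
    (H.joinEdge b (G.joinEdge a K c) (.inr c)) (.inr (.inr c)) := by
  refine ⟨⟨⟨Sum.elim (fun x => .inr (.inl x)) (Sum.elim .inl fun x => .inr (.inr x)),
      Sum.elim (fun x => .inr (.inl x)) (Sum.elim .inl fun x => .inr (.inr x)),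
      by rintro (x | x | x) <;> rfl, by rintro (x | x | x) <;> rfl⟩, ?_⟩, rfl⟩
  rintro (x | x | x) (y | y | y) <;> simp

end RootedIso

section
variable {V W : Type*} {G : SimpleGraph V} {a : V} {H : SimpleGraph W} {b : W}

theorem Connected.joinEdge (hG : G.Connected) (hH : H.Connected) : (G.joinEdge a H b).Connected :=
  hG.sum_sup_edge hH

theorem ncard_edgeSet_joinEdge [Finite V] [Finite W] :
    (G.joinEdge a H b).edgeSet.ncard = G.edgeSet.ncard + 1 + H.edgeSet.ncard := by
  have h1 : (G ⊕g H).edgeSet.ncard = G.edgeSet.ncard + H.edgeSet.ncard := by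
    rw [← Nat.card_coe_set_eq, Nat.card_congr edgeSetSumEquiv, Nat.card_sum, Nat.card_coe_set_eq,
      Nat.card_coe_set_eq]
  rw [SimpleGraph.joinEdge, edgeSet_sup, edgeSet_edge_of_ne (by simp), Set.union_singleton,
    Set.ncard_insert_of_notMem (by simp), h1]
  ring

/-- The number of vertices of degree one other than `a`. -/
def nonrootLeaves (G : SimpleGraph V) (a : V) : ℕ :=
  {v | v ≠ a ∧ (G.neighborSet v).ncard = 1}.ncard

theorem neighborSet_joinEdge_inl (v : V) : (G.joinEdge a H b).neighborSet (.inl v) =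
    Sum.inl '' G.neighborSet v ∪ {w | v = a ∧ w = .inr b} := by
  ext (w | w) <;> simp

theorem neighborSet_joinEdge_inr (v : W) : (G.joinEdge a H b).neighborSet (.inr v) =
    Sum.inr '' H.neighborSet v ∪ {w | v = b ∧ w = .inl a} := by
  ext (w | w) <;> simp [and_comm]

theorem ncard_neighborSet_joinEdge_inl_of_ne {v : V} (h : v ≠ a) :
    ((G.joinEdge a H b).neighborSet (.inl v)).ncard = (G.neighborSet v).ncard := by
  rw [neighborSet_joinEdge_inl]
  simp [h, Set.ncard_image_of_injective _ Sum.inl_injective]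

theorem ncard_neighborSet_joinEdge_inr_of_ne {v : W} (h : v ≠ b) :
    ((G.joinEdge a H b).neighborSet (.inr v)).ncard = (H.neighborSet v).ncard := by
  rw [neighborSet_joinEdge_inr]
  simp [h, Set.ncard_image_of_injective _ Sum.inr_injective]

theorem ncard_neighborSet_joinEdge_inl [Finite V] [Finite W] :
    ((G.joinEdge a H b).neighborSet (.inl a)).ncard = (G.neighborSet a).ncard + 1 := by
  rw [neighborSet_joinEdge_inl]
  simp only [true_and, Set.ofPred_eq_eq_singleton, Set.union_singleton]
  rw [Set.ncard_insert_of_notMem (by simp), Set.ncard_image_of_injective _ Sum.inl_injective]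

/-- A branch consisting of its root alone becomes a leaf; this corresponds to `max _ 1` in
`PlaneTree.leaves`. -/
theorem nonrootLeaves_joinEdge [Finite V] [Finite W] :
    (G.joinEdge a H b).nonrootLeaves (.inr b) = (G.nonrootLeaves a +
      if (G.neighborSet a).ncard = 0 then 1 else 0) + H.nonrootLeaves b := by
  have h : {v | v ≠ .inr b ∧ ((G.joinEdge a H b).neighborSet v).ncard = 1} =
      (Sum.inl '' {v | v ≠ a ∧ (G.neighborSet v).ncard = 1} ∪
        {v | v = .inl a ∧ (G.neighborSet a).ncard = 0}) ∪
      Sum.inr '' {v | v ≠ b ∧ (H.neighborSet v).ncard = 1} := by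
    ext (v | v)
    · by_cases hv : v = a
      · subst hv; simp [ncard_neighborSet_joinEdge_inl, -Set.ncard_eq_one]
      · simp [hv, ncard_neighborSet_joinEdge_inl_of_ne hv, -Set.ncard_eq_one]
    · by_cases hv : v = b
      · subst hv; simp
      · simp [hv, ncard_neighborSet_joinEdge_inr_of_ne hv, -Set.ncard_eq_one]
  rw [nonrootLeaves, h, Set.ncard_union_eq, Set.ncard_union_eq,
    Set.ncard_image_of_injective _ Sum.inl_injective,
    Set.ncard_image_of_injective _ Sum.inr_injective]
  · congr 2
    split_ifs with h' <;> simp [h']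
  · rw [Set.disjoint_left]
    rintro _ ⟨v, hv, rfl⟩ ⟨h1, -⟩
    exact hv.1 (Sum.inl_injective h1)
  · rw [Set.disjoint_left]
    rintro (v | v) <;> simp

end

end SimpleGraph

open SimpleGraph

/-! ### Graphs of plane trees -/

namespace PlaneTree

/-- The vertices of the graph obtained by identifying the root of the tree with a vertex of a graph
with vertex set `α`. -/
@[reducible] def Vert : PlaneTree → Type → Type
  | nil, α => α
  | cons s t, α => s.Vert Unit ⊕ t.Vert α

instance instFiniteVert : ∀ (t : PlaneTree) (α : Type) [Finite α], Finite (t.Vert α)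
  | nil, _, h => h
  | cons s t, α, _ =>
    have := instFiniteVert s Unit
    have := instFiniteVert t α
    inferInstanceAs (Finite (s.Vert Unit ⊕ t.Vert α))

/-- The root. -/
def root : ∀ (t : PlaneTree) {α : Type}, α → t.Vert α
  | nil, _, ρ => ρ
  | cons _ t, _, ρ => .inr (t.root ρ)

/-- The graph obtained from `Γ` by identifying its vertex `ρ` with the root of the tree. -/
def attach : ∀ (t : PlaneTree) {α : Type}, SimpleGraph α → α → SimpleGraph (t.Vert α)
  | nil, _, Γ, _ => Γ
  | cons s t, _, Γ, ρ => (s.attach ⊥ ()).joinEdge (s.root ()) (t.attach Γ ρ) (t.root ρ)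

variable {α : Type} (Γ : SimpleGraph α) (ρ : α)

theorem card_vert (α : Type) [Finite α] (t : PlaneTree) :
    Nat.card (t.Vert α) = t.size + Nat.card α := by
  induction t generalizing α with
  | nil => simp [Vert, size]
  | cons s t hs ht =>
    change Nat.card (s.Vert Unit ⊕ t.Vert α) = _
    rw [Nat.card_sum, hs, ht, size]
    simp; ring

open Classical in
theorem lapPair_attach [Fintype α] (t : PlaneTree) [Fintype (t.Vert α)] :
    (t.attach Γ ρ).lapMat.lapPair (t.root ρ) = t.pair * Γ.lapMat.lapPair ρ := by
  induction t generalizing α with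
  | nil =>
    simp only [pair, one_mul]
    congr!
  | cons s t hs ht =>
    let _ : Fintype (s.Vert Unit) := Fintype.ofFinite _
    let _ : Fintype (t.Vert α) := Fintype.ofFinite _
    have h := Matrix.lapPair_joinAt (s.attach ⊥ ()).lapMat (s.root ()) (t.attach Γ ρ).lapMat (t.root ρ)
    have h1 := @lapPair_lapMat_of_unique Unit _ (fun a b => Classical.propDecidable (a = b)) _ ⊥ ()
    rw [← lapMat_joinEdge, hs, ht, h1, mul_one, ← mul_assoc] at h
    rw [pair, ← h]
    congr!

theorem connected_attach {Γ : SimpleGraph α} (h : Γ.Connected) (t : PlaneTree) :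
    (t.attach Γ ρ).Connected := by
  induction t generalizing α with
  | nil => exact h
  | cons s t hs ht =>
    have : (⊥ : SimpleGraph Unit).Connected := (IsTree.of_subsingleton (G := ⊥)).1
    exact (hs () this).joinEdge (ht ρ h)

theorem ncard_edgeSet_attach [Finite α] (t : PlaneTree) :
    (t.attach Γ ρ).edgeSet.ncard = t.size + Γ.edgeSet.ncard := by
  induction t generalizing α with
  | nil => simp [attach, size]
  | cons s t hs ht =>
    rw [attach, ncard_edgeSet_joinEdge, hs, ht]
    simp [size]; ring

theorem isTree_attach (t : PlaneTree) : (t.attach (⊥ : SimpleGraph Unit) ()).IsTree := by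
  rw [isTree_iff_connected_and_card]
  refine ⟨connected_attach _ (IsTree.of_subsingleton (G := ⊥)).1 t, ?_⟩
  rw [Nat.card_coe_set_eq, ncard_edgeSet_attach, card_vert]
  simp

theorem exists_embedding_attach (t : PlaneTree) : ∃ f : Γ ↪g t.attach Γ ρ, f ρ = t.root ρ := by
  induction t generalizing α with
  | nil => exact ⟨Embedding.refl, rfl⟩
  | cons s t hs ht =>
    obtain ⟨f, hf⟩ := ht Γ ρ
    exact ⟨⟨⟨fun x => .inr (f x), fun x y h => f.injective (Sum.inr_injective h)⟩, by
      intro x y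
      change ((s.attach ⊥ ()).joinEdge _ _ _).Adj (.inr (f x)) (.inr (f y)) ↔ _
      rw [joinEdge_adj_inr, f.map_adj_iff]⟩, congrArg Sum.inr hf⟩

theorem nonrootLeaves_attach [Finite α] (t : PlaneTree) :
    (t.attach Γ ρ).nonrootLeaves (t.root ρ) = t.leaves + Γ.nonrootLeaves ρ := by
  classical
  induction t generalizing α with
  | nil => simp [attach, root, leaves]
  | cons s t hs ht =>
    change ((s.attach ⊥ ()).joinEdge _ _ _).nonrootLeaves (.inr (t.root ρ)) = _
    rw [nonrootLeaves_joinEdge, hs, ht]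
    have h0 : (⊥ : SimpleGraph Unit).nonrootLeaves () = 0 := by simp [nonrootLeaves]
    have h1 : (if ((s.attach (⊥ : SimpleGraph Unit) ()).neighborSet (s.root ())).ncard = 0
        then 1 else 0) = if s = nil then 1 else 0 := by
      cases s with
      | nil =>
        simp [attach, root]
      | cons a s =>
        rw [if_neg, if_neg (by simp)]
        rw [Set.ncard_eq_zero (Set.toFinite _)]
        refine Set.Nonempty.ne_empty ⟨.inl (a.root ()), ?_⟩
        change ((a.attach ⊥ ()).joinEdge _ _ _).Adj (.inr _) (.inl _)
        rw [joinEdge_adj_inr_inl]; exact ⟨rfl, rfl⟩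
    rw [h0, h1, leaves]
    split_ifs with h
    · subst h; simp [leaves]; ring
    · rw [max_eq_left (leaves_pos h)]; ring

/-- The degree condition keeps the root from being a leaf itself. -/
theorem numLeaves_attach [Finite α] (t : PlaneTree) (h : 2 ≤ (Γ.neighborSet ρ).ncard) :
    numLeaves (t.attach Γ ρ) = t.leaves + Γ.nonrootLeaves ρ := by
  rw [← nonrootLeaves_attach, numLeaves, nonrootLeaves]
  congr 1
  ext v
  simp only [Set.mem_ofPred_eq, iff_and_self]
  rintro hv rfl
  obtain ⟨f, hf⟩ := exists_embedding_attach Γ ρ t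
  have : (f '' Γ.neighborSet ρ).ncard ≤ ((t.attach Γ ρ).neighborSet (t.root ρ)).ncard := by
    refine Set.ncard_le_ncard ?_ (Set.toFinite _)
    rintro _ ⟨w, hw, rfl⟩
    rw [← hf]
    exact f.map_adj_iff.2 hw
  rw [Set.ncard_image_of_injective _ f.injective] at this
  omega

/-- Trees that give isomorphic graphs whenever they are attached to a graph. -/
def Equivalent (s t : PlaneTree) : Prop :=
  ∀ (α : Type) (Γ : SimpleGraph α) (ρ : α),
    RootedIso (s.attach Γ ρ) (s.root ρ) (t.attach Γ ρ) (t.root ρ)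

namespace Equivalent

theorem refl (s : PlaneTree) : Equivalent s s := fun _ _ _ => .refl

theorem trans {s t u : PlaneTree} (h : Equivalent s t) (h' : Equivalent t u) : Equivalent s u :=
  fun α Γ ρ => (h α Γ ρ).trans (h' α Γ ρ)

theorem cons {s s' t t' : PlaneTree} (h : Equivalent s s') (h' : Equivalent t t') :
    Equivalent (.cons s t) (.cons s' t') :=
  fun α Γ ρ => (h Unit ⊥ ()).joinEdge (h' α Γ ρ)

theorem swap (a b t : PlaneTree) : Equivalent (.cons a (.cons b t)) (.cons b (.cons a t)) :=
  fun _ _ _ => .joinEdge_swap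

theorem stem {s t : PlaneTree} (h : Equivalent s t) (d : ℕ) :
    Equivalent (PlaneTree.stem d s) (PlaneTree.stem d t) := by
  induction d with
  | zero => exact h
  | succ d ih => exact ih.cons (refl _)

theorem legs {L M : List ℕ} (h : L.Perm M) : Equivalent (legs L) (PlaneTree.legs M) := by
  induction h with
  | nil => exact refl _
  | cons a _ ih => exact (refl _).cons ih
  | swap a b L => exact swap _ _ _
  | trans _ _ h1 h2 => exact h1.trans h2

end Equivalent

end PlaneTree

/-! ### Gluing at a vertex, and rooted trees as plane trees -/

namespace SimpleGraph

/-- `f` presents `G` as the graph obtained from `Γ` and `T` by identifying `ρ` and `r`. -/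
structure IsGluing {α β W : Type*} (Γ : SimpleGraph α) (ρ : α) (T : SimpleGraph β) (r : β)
    (G : SimpleGraph W) (f : α ⊕ β → W) : Prop where
  surj : Function.Surjective f
  ker : ∀ p q, f p = f q ↔ p = q ∨ (p = .inl ρ ∧ q = .inr r) ∨ (p = .inr r ∧ q = .inl ρ)
  adj : ∀ u v, G.Adj u v ↔ ∃ p q, f p = u ∧ f q = v ∧ (Γ ⊕g T).Adj p q

namespace IsGluing
variable {α β β' W W' : Type*} {Γ : SimpleGraph α} {ρ : α} {T : SimpleGraph β} {r : β}
  {T' : SimpleGraph β'} {r' : β'} {G : SimpleGraph W} {G' : SimpleGraph W'}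
  {f : α ⊕ β → W} {f' : α ⊕ β → W'}

/-- Both graphs are the quotient of the same disjoint union by the same relation. -/
theorem nonempty_iso (h : IsGluing Γ ρ T r G f) (h' : IsGluing Γ ρ T r G' f') :
    Nonempty (G ≃g G') := by
  have hk : ∀ p q, f p = f q ↔ f' p = f' q := fun p q => (h.ker p q).trans (h'.ker p q).symm
  let s := Function.surjInv h.surj
  let s' := Function.surjInv h'.surj
  have hs : ∀ w, f (s w) = w := Function.surjInv_eq h.surj
  have hs' : ∀ w, f' (s' w) = w := Function.surjInv_eq h'.surj
  refine ⟨⟨⟨fun w => f' (s w), fun w => f (s' w), fun w => ?_, fun w => ?_⟩, fun {u v} => ?_⟩⟩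
  · exact ((hk _ _).2 (hs' _)).trans (hs w)
  · exact ((hk _ _).1 (hs _)).trans (hs' w)
  · change G'.Adj (f' (s u)) (f' (s v)) ↔ _
    rw [h'.adj, h.adj]
    simp only [← hk, hs]

theorem of_rootedIso (h : IsGluing Γ ρ T r G f) (e : RootedIso T' r' T r) :
    ∃ f', IsGluing Γ ρ T' r' G f' := by
  obtain ⟨e, rfl⟩ := e
  refine ⟨f ∘ Sum.map id e, ?_, fun p q => ?_, fun u v => ?_⟩
  · exact h.surj.comp (Function.surjective_id.sumMap e.surjective)
  · simp only [Function.comp_apply, h.ker]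
    rcases p with p | p <;> rcases q with q | q <;> simp
  · rw [h.adj]
    constructor
    · rintro ⟨p, q, rfl, rfl, hpq⟩
      refine ⟨Sum.map id e.symm p, Sum.map id e.symm q, ?_, ?_, ?_⟩
      · rcases p with p | p <;> simp
      · rcases q with q | q <;> simp
      · rcases p with p | p <;> rcases q with q | q <;> simp_all [e.symm.map_adj_iff]
    · rintro ⟨p, q, rfl, rfl, hpq⟩
      refine ⟨_, _, rfl, rfl, ?_⟩
      rcases p with p | p <;> rcases q with q | q <;> simp_all [e.map_adj_iff]

end IsGluing

theorem isGluing_cycleAttach {g : ℕ} {V : Fin g → Type} (T : ∀ i, SimpleGraph (V i)) (r : ∀ i, V i)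
    (i₀ : Fin g) (h : ∀ i, i ≠ i₀ → Subsingleton (V i)) :
    IsGluing (cycleGraph g) i₀ (T i₀) (r i₀) (cycleAttach T r)
      (Sum.elim (fun i => ⟨i, r i⟩) fun x => ⟨i₀, x⟩) where
  surj := by
    rintro ⟨i, x⟩
    by_cases hi : i = i₀
    · subst hi; exact ⟨.inr x, rfl⟩
    · have := h i hi
      exact ⟨.inl i, by simp [Subsingleton.elim x (r i)]⟩
  ker := by
    have key : ∀ i x, (⟨i, r i⟩ : Σ i, V i) = ⟨i₀, x⟩ ↔ i = i₀ ∧ x = r i₀ := by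
      intro i x
      constructor
      · intro h
        obtain rfl : i = i₀ := congrArg Sigma.fst h
        exact ⟨rfl, (eq_of_heq (Sigma.mk.inj h).2).symm⟩
      · rintro ⟨rfl, rfl⟩; rfl
    rintro (p | p) (q | q)
    · simp only [Sum.elim_inl]
      constructor
      · intro h; left; exact congrArg Sum.inl (congrArg Sigma.fst h)
      · intro h; simp at h; rw [h]
    · simp [key]
    · simp only [Sum.elim_inl, Sum.elim_inr]
      rw [eq_comm, key]; simp [and_comm]
    · simp
  adj := by
    intro u v
    constructor
    · rintro (⟨i, x, y, rfl, rfl, hxy⟩ | ⟨h1, h2, h3⟩)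
      · by_cases hi : i = i₀
        · subst hi; exact ⟨.inr x, .inr y, rfl, rfl, by simpa using hxy⟩
        · have := h i hi
          exact absurd (Subsingleton.elim x y) hxy.ne
      · exact ⟨.inl u.1, .inl v.1, by simp [← h1], by simp [← h2], by simpa using h3⟩
    · rintro ⟨p | p, q | q, rfl, rfl, hpq⟩
      · exact Or.inr ⟨rfl, rfl, by simpa using hpq⟩
      · simp at hpq
      · simp at hpq
      · exact Or.inl ⟨i₀, p, q, rfl, rfl, by simpa using hpq⟩

end SimpleGraph

open SimpleGraph

namespace PlaneTree

/-- Relates the recursive construction to gluing, so that it can be matched with `cycleAttach`,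
whose vertex type is built differently. -/
theorem exists_isGluing_attach {α : Type} (Γ : SimpleGraph α) (ρ : α) (t : PlaneTree) :
    ∃ f : α ⊕ t.Vert Unit → t.Vert α, f (.inl ρ) = t.root ρ ∧
      IsGluing Γ ρ (t.attach ⊥ ()) (t.root ()) (t.attach Γ ρ) f := by
  induction t with
  | nil =>
    refine ⟨Sum.elim id fun _ => ρ, rfl, fun w => ⟨.inl w, rfl⟩, ?_, ?_⟩
    · rintro (p | p) (q | q) <;> simp [root, eq_comm]
    · intro u v
      constructor
      · intro h; exact ⟨.inl u, .inl v, rfl, rfl, by have h' : Γ.Adj u v := h; simpa using h'⟩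
      · rintro ⟨p | p, q | q, rfl, rfl, hpq⟩ <;> simp [attach] at hpq
        exact hpq
  | cons s t hs ht =>
    obtain ⟨f, hr, hf⟩ := ht
    have hr' : f (.inr (t.root ())) = t.root ρ := by rw [← hr, hf.ker]; simp
    refine ⟨Sum.elim (fun x => .inr (f (.inl x))) (Sum.elim .inl fun x => .inr (f (.inr x))),
      congrArg Sum.inr hr, ?_, ?_, ?_⟩
    · rintro (w | w)
      · exact ⟨.inr (.inl w), rfl⟩
      · obtain ⟨p | p, rfl⟩ := hf.surj w
        · exact ⟨.inl p, rfl⟩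
        · exact ⟨.inr (.inr p), rfl⟩
    · rintro (p | p | p) (q | q | q) <;> simp [root, hf.ker]
    · intro u v
      have hker : ∀ p, f p = t.root ρ ↔ p = .inl ρ ∨ p = .inr (t.root ()) := by
        intro p; rw [← hr, hf.ker]; simp
      constructor
      · intro h
        rcases u with u | u <;> rcases v with v | v
        · exact ⟨.inr (.inl u), .inr (.inl v), rfl, rfl, by simpa [attach] using h⟩
        · simp only [attach, joinEdge_adj_inl_inr] at h
          obtain ⟨rfl, rfl⟩ := h
          exact ⟨.inr (.inl (s.root ())), .inr (.inr (t.root ())), rfl, congrArg Sum.inr hr',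
            by simp [attach]⟩
        · simp only [attach, joinEdge_adj_inr_inl] at h
          obtain ⟨rfl, rfl⟩ := h
          exact ⟨.inr (.inr (t.root ())), .inr (.inl (s.root ())), congrArg Sum.inr hr', rfl,
            by simp [attach]⟩
        · simp only [attach, joinEdge_adj_inr, hf.adj] at h
          obtain ⟨p | p, q | q, rfl, rfl, hpq⟩ := h
          · exact ⟨.inl p, .inl q, rfl, rfl, by simpa using hpq⟩
          · simp at hpq
          · simp at hpq
          · exact ⟨.inr (.inr p), .inr (.inr q), rfl, rfl, by simpa [attach] using hpq⟩
      · rintro ⟨p | p | p, q | q | q, rfl, rfl, hpq⟩ <;> simp [attach] at hpq ⊢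
        · exact (hf.adj _ _).2 ⟨.inl p, .inl q, rfl, rfl, by simpa using hpq⟩
        · exact hpq
        · exact ⟨hpq.1, by rw [hpq.2, hr']⟩
        · exact ⟨hpq.1, by rw [hpq.2, hr']⟩
        · exact (hf.adj _ _).2 ⟨.inr p, .inr q, rfl, rfl, by simpa using hpq⟩

theorem nonempty_cycleAttach_iso {g : ℕ} {V : Fin g → Type} {T : ∀ i, SimpleGraph (V i)}
    {r : ∀ i, V i} {i₀ : Fin g} (h : ∀ i, i ≠ i₀ → Subsingleton (V i)) {t : PlaneTree}
    (ht : RootedIso (T i₀) (r i₀) (t.attach ⊥ ()) (t.root ())) :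
    Nonempty (cycleAttach T r ≃g t.attach (cycleGraph g) i₀) := by
  obtain ⟨f, -, hf⟩ := t.exists_isGluing_attach (cycleGraph g) i₀
  obtain ⟨f', hf'⟩ := hf.of_rootedIso ht
  exact (isGluing_cycleAttach T r i₀ h).nonempty_iso hf'

/-- Every finite rooted tree is isomorphic to the graph of a plane tree. -/
theorem exists_rootedIso_attach {β : Type} [Finite β] (T : SimpleGraph β) (r : β) (hT : T.IsTree) :
    ∃ t : PlaneTree, RootedIso T r (t.attach ⊥ ()) (t.root ()) := by
  induction h : Nat.card β using Nat.strong_induction_on generalizing β with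
  | _ n ih =>
  by_cases hc : ∃ c, T.Adj r c
  · obtain ⟨c, hc⟩ := hc
    -- Without the edge `r c` the tree has two components: that of `c` is the first branch, that of
    -- `r` the remaining tree.
    set T' := T.deleteEdges {s(r, c)} with hT'
    have hac : T'.IsAcyclic := hT.2.anti (deleteEdges_le _)
    have hbr : T.IsBridge s(r, c) := isAcyclic_iff_forall_adj_isBridge.1 hT.2 hc
    have hnr : ¬ T'.Reachable r c := isBridge_iff.1 hbr
    have hcov : ∀ v, T'.Reachable r v ∨ T'.Reachable c v := by
      intro v
      have hv := hT.1.preconnected r v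
      rw [reachable_iff_reflTransGen] at hv
      induction hv with
      | refl => exact .inl .rfl
      | @tail b v _ hbv ihb =>
        by_cases he : s(b, v) = s(r, c)
        · rcases Sym2.eq_iff.1 he with ⟨-, rfl⟩ | ⟨-, rfl⟩
          · exact .inr .rfl
          · exact .inl .rfl
        · have h' : T'.Adj b v := by simp [hT', deleteEdges_adj, hbv, he]
          exact ihb.imp (·.trans h'.reachable) (·.trans h'.reachable)
    have hdis : ∀ v, T'.Reachable r v → T'.Reachable c v → False :=
      fun v h1 h2 => hnr (h1.trans h2.symm)
    let A := {v // v ∈ (T'.connectedComponentMk c).supp}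
    let B := {v // v ∈ (T'.connectedComponentMk r).supp}
    have hA : ∀ v, v ∈ (T'.connectedComponentMk c).supp ↔ T'.Reachable c v := fun v => by
      rw [ConnectedComponent.mem_supp_iff, ConnectedComponent.eq, reachable_comm]
    have hB : ∀ v, v ∈ (T'.connectedComponentMk r).supp ↔ T'.Reachable r v := fun v => by
      rw [ConnectedComponent.mem_supp_iff, ConnectedComponent.eq, reachable_comm]
    let a : A := ⟨c, (hA c).2 .rfl⟩
    let b : B := ⟨r, (hB r).2 .rfl⟩
    have hbij : Function.Bijective (Sum.elim Subtype.val Subtype.val : A ⊕ B → β) := by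
      constructor
      · rintro (⟨x, hx⟩ | ⟨x, hx⟩) (⟨y, hy⟩ | ⟨y, hy⟩) hxy <;> simp only [Sum.elim_inl, Sum.elim_inr] at hxy
        · subst hxy; rfl
        · subst hxy; exact (hdis _ ((hB _).1 hy) ((hA _).1 hx)).elim
        · subst hxy; exact (hdis _ ((hB _).1 hx) ((hA _).1 hy)).elim
        · subst hxy; rfl
      · intro v
        rcases hcov v with h | h
        · exact ⟨.inr ⟨v, (hB v).2 h⟩, rfl⟩
        · exact ⟨.inl ⟨v, (hA v).2 h⟩, rfl⟩
    have hadj : ∀ x y, T.Adj x y ↔ T'.Adj x y ∨ (x = r ∧ y = c) ∨ (x = c ∧ y = r) := by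
      intro x y
      rw [hT', deleteEdges_adj, Set.mem_singleton_iff, Sym2.eq_iff]
      constructor
      · intro h; tauto
      · rintro (h | ⟨rfl, rfl⟩ | ⟨rfl, rfl⟩)
        · exact h.1
        · exact hc
        · exact hc.symm
    have hcard : Nat.card A + Nat.card B = Nat.card β := by
      rw [← Nat.card_sum]; exact Nat.card_congr (Equiv.ofBijective _ hbij)
    have hposA : 0 < Nat.card A := Nat.card_pos_iff.2 ⟨⟨a⟩, inferInstance⟩
    have hposB : 0 < Nat.card B := Nat.card_pos_iff.2 ⟨⟨b⟩, inferInstance⟩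
    obtain ⟨s, hs⟩ := ih (Nat.card A) (by omega) (T'.connectedComponentMk c).toSimpleGraph a
      (hac.isTree_connectedComponent _) rfl
    obtain ⟨t, ht⟩ := ih (Nat.card B) (by omega) (T'.connectedComponentMk r).toSimpleGraph b
      (hac.isTree_connectedComponent _) rfl
    refine ⟨cons s t, RootedIso.trans (RootedIso.symm ?_) (hs.joinEdge ht)⟩
    refine ⟨⟨Equiv.ofBijective _ hbij, ?_⟩, rfl⟩
    have hAadj : ∀ x y : A, (T'.connectedComponentMk c).toSimpleGraph.Adj x y ↔ T'.Adj x.1 y.1 :=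
      fun _ _ => Iff.rfl
    have hBadj : ∀ x y : B, (T'.connectedComponentMk r).toSimpleGraph.Adj x y ↔ T'.Adj x.1 y.1 :=
      fun _ _ => Iff.rfl
    have nA : ∀ x : A, x.1 ≠ r := fun x h => hdis r .rfl (h ▸ (hA x.1).1 x.2)
    have nB : ∀ x : B, x.1 ≠ c := fun x h => hdis c (h ▸ (hB x.1).1 x.2) .rfl
    have nAB : ∀ (x : A) (y : B), ¬ T'.Adj x.1 y.1 := fun x y h =>
      hdis y.1 ((hB _).1 y.2) (((hA _).1 x.2).trans h.reachable)
    rintro (x | x) (y | y) <;> simp only [Equiv.ofBijective_apply, Sum.elim_inl, Sum.elim_inr, hadj,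
      joinEdge_adj_inl, joinEdge_adj_inr, joinEdge_adj_inl_inr, joinEdge_adj_inr_inl]
    · simp [nA, hAadj]
    · simp [nA, nAB, Subtype.ext_iff, a, b]
    · have := nAB y x
      rw [adj_comm] at this
      simp [nB, this, Subtype.ext_iff, a, b, and_comm]
    · simp [nB, hBadj]
  · have : Subsingleton β := by
      by_contra hns
      rw [not_subsingleton_iff_nontrivial] at hns
      obtain ⟨c, hc'⟩ := hT.1.preconnected.exists_adj_of_nontrivial r
      exact hc ⟨c, hc'⟩
    refine ⟨nil, ⟨⟨⟨fun _ => (), fun _ => r, fun _ => Subsingleton.elim _ _, fun _ => rfl⟩, ?_⟩, rfl⟩⟩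
    intro u v
    simp only [attach, bot_adj, false_iff]
    exact fun h => h.ne (Subsingleton.elim _ _)

end PlaneTree

/-! ### The girth of a unicyclic graph -/

namespace SimpleGraph

/-- Deleting an edge of `c` leaves a tree, so every cycle, in particular a shortest one, contains
all edges of `c`. -/
theorem girth_eq_length_of_isUnicyclic {V : Type*} [Finite V] {G : SimpleGraph V}
    (hG : IsUnicyclic G) {v : V} {c : G.Walk v v} (hc : c.IsCycle) : G.girth = c.length := by
  refine le_antisymm (girth_le_length hc) ?_
  obtain ⟨u, w, hw, hgw⟩ := exists_girth_eq_length.2 fun h => h c hc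
  rw [hgw]
  have key : c.edges ⊆ w.edges := by
    intro e he
    by_contra hew
    induction e with | h x y
    have heG : s(x, y) ∈ G.edgeSet := c.edges_subset_edgeSet he
    have hconn : (G.deleteEdges {s(x, y)}).Connected :=
      hG.1.connected_delete_edge_of_not_isBridge fun hb => hb.notMem_edges_of_isCycle hc he
    have htree : (G.deleteEdges {s(x, y)}).IsTree := by
      rw [isTree_iff_connected_and_card]
      refine ⟨hconn, ?_⟩
      rw [Nat.card_coe_set_eq, edgeSet_deleteEdges, Set.ncard_sdiff_singleton_add_one heG, hG.2]
    exact htree.2 _ (Walk.IsCycle.toDeleteEdges G ({s(x, y)} : Set (Sym2 V)) hw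
      (by rintro e he rfl; exact hew he))
  have := (List.Nodup.subperm hc.edges_nodup key).length_le
  simpa using this

end SimpleGraph

/-! ### The graphs `U^i` as plane trees attached to a cycle -/

namespace SimpleGraph

/-- The graph obtained from `Γ` by identifying its vertex `ρ` with an end of each of `m` disjoint
paths, the `j`-th of which has `len j` edges. -/
def legGraph {α : Type*} (Γ : SimpleGraph α) (ρ : α) {m : ℕ} (len : Fin m → ℕ) :
    SimpleGraph (α ⊕ Σ j, Fin (len j)) where
  Adj
    | .inl a, .inl b => Γ.Adj a b
    | .inl a, .inr x => a = ρ ∧ x.2.val = 0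
    | .inr x, .inl a => a = ρ ∧ x.2.val = 0
    | .inr x, .inr y => x.1 = y.1 ∧ (x.2.val + 1 = y.2.val ∨ y.2.val + 1 = x.2.val)
  symm := ⟨by
    rintro (a | x) (b | y) h
    · exact h.symm
    · exact h
    · exact h
    · exact ⟨h.1.symm, h.2.symm⟩⟩
  loopless := ⟨by
    rintro (a | x) h
    · exact Γ.loopless.irrefl a h
    · have := h.2; omega⟩

theorem RootedIso.of_bijective {V W : Type*} {G : SimpleGraph V} {a : V} {H : SimpleGraph W} {b : W}
    (f : V → W) (hf : f.Bijective) (h : ∀ x y, H.Adj (f x) (f y) ↔ G.Adj x y) (hab : f a = b) :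
    RootedIso G a H b :=
  ⟨⟨Equiv.ofBijective f hf, h _ _⟩, hab⟩

section
variable {α : Type*} {Γ : SimpleGraph α} {ρ : α} {m : ℕ} {len : Fin m → ℕ}

@[simp] theorem legGraph_adj_inl {a b : α} :
    (legGraph Γ ρ len).Adj (.inl a) (.inl b) ↔ Γ.Adj a b := Iff.rfl

@[simp] theorem legGraph_adj_inl_inr {a : α} {x : Σ j, Fin (len j)} :
    (legGraph Γ ρ len).Adj (.inl a) (.inr x) ↔ a = ρ ∧ x.2.val = 0 := Iff.rfl

@[simp] theorem legGraph_adj_inr_inl {a : α} {x : Σ j, Fin (len j)} :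
    (legGraph Γ ρ len).Adj (.inr x) (.inl a) ↔ a = ρ ∧ x.2.val = 0 := Iff.rfl

@[simp] theorem legGraph_adj_inr {x y : Σ j, Fin (len j)} :
    (legGraph Γ ρ len).Adj (.inr x) (.inr y) ↔
      x.1 = y.1 ∧ (x.2.val + 1 = y.2.val ∨ y.2.val + 1 = x.2.val) := Iff.rfl

theorem joinEdge_pathGraph (b : ℕ) : RootedIso
    ((pathGraph (b + 1)).joinEdge 0 (⊥ : SimpleGraph Unit) ()) (.inr ()) (pathGraph (b + 2)) 0 := by
  refine .of_bijective (Sum.elim Fin.succ fun _ => 0) ⟨?_, ?_⟩ ?_ rfl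
  · rintro (x | x) (y | y) <;> simp [Fin.succ_ne_zero, (Fin.succ_ne_zero _).symm]
  · intro x
    refine Fin.cases ⟨.inr (), rfl⟩ (fun x => ⟨.inl x, rfl⟩) x
  · rintro (x | x) (y | y) <;> simp [pathGraph_adj, Fin.ext_iff, -Fin.val_eq_zero_iff]

theorem joinEdge_legGraph_pathGraph (q : ℕ) : RootedIso
    ((legGraph (pathGraph (q + 1)) (Fin.last q) len).joinEdge (.inl 0) (⊥ : SimpleGraph Unit) ())
    (.inr ()) (legGraph (pathGraph (q + 2)) (Fin.last (q + 1)) len) (.inl 0) := by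
  refine .of_bijective (Sum.elim (Sum.map Fin.succ id) fun _ => .inl 0) ⟨?_, ?_⟩ ?_ rfl
  · rintro ((x | x) | x) ((y | y) | y) <;> simp [Fin.succ_ne_zero, (Fin.succ_ne_zero _).symm]
  · rintro (x | x)
    · exact Fin.cases ⟨.inr (), rfl⟩ (fun x => ⟨.inl (.inl x), rfl⟩) x
    · exact ⟨.inl (.inr x), rfl⟩
  · rintro ((x | x) | x) ((y | y) | y) <;> simp [pathGraph_adj, Fin.ext_iff, -Fin.val_eq_zero_iff]

theorem joinEdge_pathGraph_legGraph {a : Fin (m + 1) → ℕ} : RootedIso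
    ((pathGraph (a 0 + 1)).joinEdge 0 (legGraph Γ ρ fun j => a j.succ + 1) (.inl ρ))
    (.inr (.inl ρ)) (legGraph Γ ρ fun j => a j + 1) (.inl ρ) := by
  refine .of_bijective (Sum.elim (fun x => .inr ⟨0, x⟩)
    (Sum.elim .inl fun x => .inr ⟨x.1.succ, x.2⟩)) ⟨?_, ?_⟩ ?_ rfl
  · rintro (x | x | ⟨i, x⟩) (y | y | ⟨j, y⟩) h
    · simpa using h
    · simp at h
    · have := congrArg Sigma.fst (Sum.inr_injective h)
      exact absurd this (Fin.succ_ne_zero _).symm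
    · simp at h
    · simpa using h
    · simp at h
    · have := congrArg Sigma.fst (Sum.inr_injective h)
      exact absurd this (Fin.succ_ne_zero _)
    · simp at h
    · have h' := Sum.inr_injective h
      obtain rfl : i = j := Fin.succ_injective _ (congrArg Sigma.fst h')
      have := eq_of_heq (Sigma.mk.inj h').2
      simp at this
      rw [this]
  · rintro (x | ⟨j, x⟩)
    · exact ⟨.inr (.inl x), rfl⟩
    · revert x
      exact Fin.cases (fun x => ⟨.inl x, rfl⟩) (fun j x => ⟨.inr (.inr ⟨j, x⟩), rfl⟩) j
  · rintro (x | x | ⟨i, x⟩) (y | y | ⟨j, y⟩) <;>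
      simp [pathGraph_adj, Fin.ext_iff, and_comm, -Fin.val_eq_zero_iff]

end

end SimpleGraph

open SimpleGraph

namespace PlaneTree

theorem rootedIso_attach_stem_nil (b : ℕ) : RootedIso ((stem b nil).attach ⊥ ())
    ((stem b nil).root ()) (pathGraph (b + 1)) 0 := by
  induction b with
  | zero => exact ⟨⟨Equiv.ofUnique Unit (Fin 1), fun {x y} => by
      simp [stem, attach, pathGraph_adj]; exact fun h => h⟩, rfl⟩
  | succ b ih => exact (ih.joinEdge .refl).trans (joinEdge_pathGraph b)

theorem rootedIso_attach_legs {α : Type} (Γ : SimpleGraph α) (ρ : α) {m : ℕ} {a len : Fin m → ℕ}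
    (h : ∀ j, len j = a j + 1) : RootedIso ((legs (List.ofFn a)).attach Γ ρ)
      ((legs (List.ofFn a)).root ρ) (legGraph Γ ρ len) (.inl ρ) := by
  obtain rfl : len = fun j => a j + 1 := funext h
  clear h
  induction m with
  | zero =>
    rw [List.ofFn_zero]
    exact ⟨⟨(Equiv.sumEmpty α _).symm, fun {x y} => Iff.rfl⟩, rfl⟩
  | succ m ih =>
    rw [List.ofFn_succ]
    exact ((rootedIso_attach_stem_nil _).joinEdge ih).trans joinEdge_pathGraph_legGraph

theorem rootedIso_attach_stem_legs (q : ℕ) {m : ℕ} {a len : Fin m → ℕ}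
    (h : ∀ j, len j = a j + 1) : RootedIso ((stem q (legs (List.ofFn a))).attach ⊥ ())
      ((stem q (legs (List.ofFn a))).root ()) (legGraph (pathGraph (q + 1)) (Fin.last q) len)
      (.inl 0) := by
  induction q with
  | zero =>
    refine (rootedIso_attach_legs ⊥ () h).trans
      ⟨⟨Equiv.sumCongr (Equiv.ofUnique Unit (Fin 1)) (Equiv.refl _), ?_⟩, rfl⟩
    rintro (x | x) (y | y) <;> simp
  | succ q ih => exact (ih.joinEdge .refl).trans (joinEdge_legGraph_pathGraph q)

end PlaneTree

/-- Entries of `PlaneTree.legs` are lengths minus one; this is why `starTree` distributes `N - i -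
l`. -/
theorem legLength_eq_add_one {N l : ℕ} (h : l ≤ N) (j : Fin l) :
    legLength N l j = legLength (N - l) l j + 1 := by
  have hl : 0 < l := j.pos
  obtain ⟨M, rfl⟩ := Nat.exists_eq_add_of_le' h
  simp only [legLength, Nat.add_mod_right, Nat.add_div_right _ hl, Nat.add_sub_cancel]
  split_ifs <;> rfl

section
variable {n l g i : ℕ}

theorem starUni_adj_inl {a b : Fin g} :
    (starUni n l g i).Adj (.inl a) (.inl b) ↔ (cycleGraph g).Adj a b := by
  simp only [starUni, fromRel_adj, StarUniRel, adj_comm _ b a, or_self, and_iff_right_iff_imp]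
  exact fun h h' => h.ne (Sum.inl_injective h')

theorem starUni_adj_inr_inr {x y : Σ j, Fin (legLength (n - g - i) l j)} :
    (starUni n l g i).Adj (.inr (.inr x)) (.inr (.inr y)) ↔
      x.1 = y.1 ∧ (x.2.val + 1 = y.2.val ∨ y.2.val + 1 = x.2.val) := by
  simp only [starUni, fromRel_adj, StarUniRel]
  constructor
  · rintro ⟨-, ⟨h, h'⟩ | ⟨h, h'⟩⟩
    · exact ⟨h, .inl h'.symm⟩
    · exact ⟨h.symm, .inr h'.symm⟩
  · rintro ⟨h, h'⟩
    refine ⟨?_, h'.imp (fun h' => ⟨h, h'.symm⟩) fun h' => ⟨h.symm, h'.symm⟩⟩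
    rintro h''
    obtain rfl := Sum.inr_injective (Sum.inr_injective h'')
    omega

theorem nonempty_starUni_iso (hg : 0 < g) (h : i + l ≤ n - g) :
    Nonempty (starUni n l g i ≃g (PlaneTree.starTree (n - g) l i).attach (cycleGraph g) ⟨0, hg⟩) := by
  have hlen : ∀ j, legLength (n - g - i) l j = legLength (n - g - i - l) l j + 1 :=
    fun j => legLength_eq_add_one (by omega) j
  -- Without a stem the centre is the cycle vertex; otherwise a path on `q + 1` vertices and the
  -- edge joining it to the cycle form the stem with `q + 1` edges.
  cases i with
  | zero =>
    obtain ⟨e, -⟩ := PlaneTree.rootedIso_attach_legs (cycleGraph g) ⟨0, hg⟩ hlen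
    suffices h : RootedIso (legGraph (cycleGraph g) ⟨0, hg⟩ (legLength (n - g - 0) l))
        (.inl ⟨0, hg⟩) (starUni n l g 0) (.inl ⟨0, hg⟩) by
      obtain ⟨f, -⟩ := h
      exact ⟨(e.trans f).symm⟩
    refine .of_bijective (Sum.map id .inr) ⟨?_, ?_⟩ ?_ rfl
    · exact Function.injective_id.sumMap Sum.inr_injective
    · rintro (x | x | x)
      exacts [⟨.inl x, rfl⟩, x.elim0, ⟨.inr x, rfl⟩]
    · rintro (x | x) (y | y) <;> simp only [Sum.map_inl, Sum.map_inr, id]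
      · rw [starUni_adj_inl, legGraph_adj_inl]
      · simp [starUni, StarUniRel, Fin.ext_iff, -Fin.val_eq_zero_iff]
      · simp [starUni, StarUniRel, Fin.ext_iff, -Fin.val_eq_zero_iff]
      · rw [starUni_adj_inr_inr, legGraph_adj_inr]
  | succ q =>
    obtain ⟨e, -⟩ := (PlaneTree.rootedIso_attach_stem_legs q hlen).joinEdge
      (.refl (G := cycleGraph g) (a := ⟨0, hg⟩))
    suffices h : RootedIso ((legGraph (pathGraph (q + 1)) (Fin.last q)
        (legLength (n - g - (q + 1)) l)).joinEdge (.inl 0) (cycleGraph g) ⟨0, hg⟩)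
        (.inr ⟨0, hg⟩) (starUni n l g (q + 1)) (.inl ⟨0, hg⟩) by
      obtain ⟨f, -⟩ := h
      exact ⟨(e.trans f).symm⟩
    refine .of_bijective (Sum.elim .inr .inl) ⟨?_, ?_⟩ ?_ rfl
    · exact Sum.inr_injective.sumElim Sum.inl_injective (by simp)
    · rintro (x | x)
      exacts [⟨.inr x, rfl⟩, ⟨.inl x, rfl⟩]
    · rintro ((x | x) | x) ((y | y) | y) <;>
        simp only [Sum.elim_inl, Sum.elim_inr, joinEdge_adj_inl, joinEdge_adj_inr,
          joinEdge_adj_inl_inr, joinEdge_adj_inr_inl, starUni_adj_inl, starUni_adj_inr_inr,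
          legGraph_adj_inl, legGraph_adj_inr, legGraph_adj_inl_inr, legGraph_adj_inr_inl]
      · simp [starUni, StarUniRel, Fin.ext_iff, pathGraph_adj, -Fin.val_eq_zero_iff]
        omega
      all_goals
        simp [starUni, StarUniRel, Fin.ext_iff, and_comm, -Fin.val_eq_zero_iff]

end

/-! ### The class in terms of plane trees -/

namespace SimpleGraph

section
variable {k : ℕ}

theorem ncard_neighborSet_cycleGraph (v : Fin (k + 3)) :
    ((cycleGraph (k + 3)).neighborSet v).ncard = 2 := by
  rw [← Nat.card_coe_set_eq, Nat.card_eq_fintype_card, card_neighborSet_eq_degree,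
    cycleGraph_degree_three_le]

theorem ncard_edgeSet_cycleGraph : (cycleGraph (k + 3)).edgeSet.ncard = k + 3 := by
  have h := sum_degrees_eq_twice_card_edges (cycleGraph (k + 3))
  simp only [cycleGraph_degree_three_le, Finset.sum_const, Finset.card_univ, Fintype.card_fin,
    smul_eq_mul] at h
  rw [← coe_edgeFinset, Set.ncard_coe_finset]
  omega

theorem nonrootLeaves_cycleGraph (v : Fin (k + 3)) : (cycleGraph (k + 3)).nonrootLeaves v = 0 := by
  simp [nonrootLeaves, ncard_neighborSet_cycleGraph, -Set.ncard_eq_one]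

variable (t : PlaneTree)

theorem isUnicyclic_attach_cycleGraph (v : Fin (k + 3)) :
    IsUnicyclic (t.attach (cycleGraph (k + 3)) v) := by
  refine ⟨t.connected_attach v cycleGraph_connected, ?_⟩
  rw [PlaneTree.ncard_edgeSet_attach, PlaneTree.card_vert, ncard_edgeSet_cycleGraph, Nat.card_fin]

theorem numLeaves_attach_cycleGraph (v : Fin (k + 3)) :
    numLeaves (t.attach (cycleGraph (k + 3)) v) = t.leaves := by
  rw [PlaneTree.numLeaves_attach _ _ _ (ncard_neighborSet_cycleGraph v).ge,
    nonrootLeaves_cycleGraph, add_zero]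

theorem girth_attach_cycleGraph (v : Fin (k + 3)) :
    (t.attach (cycleGraph (k + 3)) v).girth = k + 3 := by
  obtain ⟨f, -⟩ := t.exists_embedding_attach (cycleGraph (k + 3)) v
  rw [girth_eq_length_of_isUnicyclic (isUnicyclic_attach_cycleGraph t v)
    (cycleGraph.isCycle_cycle.map (f := f.toHom) f.injective), Walk.length_map,
    cycleGraph.length_cycle]

end

section
variable {V W : Type*} {G : SimpleGraph V} {H : SimpleGraph W}

theorem _root_.IsUnicyclic.of_iso (hH : IsUnicyclic H) (e : G ≃g H) : IsUnicyclic G := by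
  refine ⟨e.connected_iff.2 hH.1, ?_⟩
  rw [← Nat.card_coe_set_eq, Nat.card_congr e.mapEdgeSet, Nat.card_coe_set_eq, hH.2,
    Nat.card_congr e.toEquiv]

theorem numLeaves_iso (e : G ≃g H) : numLeaves G = numLeaves H := by
  have h (v : V) : (H.neighborSet (e v)).ncard = (G.neighborSet v).ncard := by
    rw [← Nat.card_coe_set_eq, ← Nat.card_coe_set_eq, Nat.card_congr (e.mapNeighborSet v)]
  rw [numLeaves, numLeaves, ← Set.ncard_image_of_injective _ e.injective]
  congr 1
  ext w
  obtain ⟨v, rfl⟩ := e.surjective w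
  simp [h, -Set.ncard_eq_one]

end

theorem mem_singleRootClass_iff {n l k : ℕ} (hn : k + 3 ≤ n) {G : SimpleGraph (Fin n)} :
    G ∈ singleRootClass n l (k + 3) ↔ ∃ t : PlaneTree, t.size = n - (k + 3) ∧ t.leaves = l ∧
      Nonempty (G ≃g t.attach (cycleGraph (k + 3)) 0) := by
  constructor
  · rintro ⟨⟨-, hl, -⟩, V, T, r, hT, hV, ⟨e⟩⟩
    have hfin : Finite (V 0) := Finite.of_injective (fun x => e.symm ⟨0, x⟩) fun x y h => by
      simpa using h
    obtain ⟨t, ht⟩ := PlaneTree.exists_rootedIso_attach (T 0) (r 0) (hT 0)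
    obtain ⟨f⟩ := PlaneTree.nonempty_cycleAttach_iso (T := T) (r := r) (i₀ := 0)
      (fun i hi => (Nat.card_eq_one_iff_unique.1 (hV i fun h => hi (Fin.ext h))).1) ht
    have e' := e.trans f
    refine ⟨t, ?_, ?_, ⟨e'⟩⟩
    · have := Nat.card_congr e'.toEquiv
      rw [PlaneTree.card_vert, Nat.card_fin, Nat.card_fin] at this
      omega
    · rw [← hl, numLeaves_iso e', numLeaves_attach_cycleGraph]
  · rintro ⟨t, hs, rfl, ⟨e⟩⟩
    refine ⟨⟨IsUnicyclic.of_iso (isUnicyclic_attach_cycleGraph t 0) e, ?_, ?_⟩, ?_⟩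
    · rw [numLeaves_iso e, numLeaves_attach_cycleGraph]
    · rw [e.girth_eq, girth_attach_cycleGraph]
    -- The whole tree over the cycle vertex `0`, only the root over the others.
    let V (i : Fin (k + 3)) : Type := {x : t.Vert Unit // i.val = 0 ∨ x = t.root ()}
    let T (i : Fin (k + 3)) : SimpleGraph (V i) := (t.attach ⊥ ()).comap Subtype.val
    let r (i : Fin (k + 3)) : V i := ⟨t.root (), .inr rfl⟩
    have hsub (i : Fin (k + 3)) (hi : i.val ≠ 0) : Subsingleton (V i) :=
      ⟨fun x y => Subtype.ext ((x.2.resolve_left hi).trans (y.2.resolve_left hi).symm)⟩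
    have e0 (i : Fin (k + 3)) (hi : i.val = 0) : T i ≃g t.attach ⊥ () :=
      ⟨Equiv.subtypeUnivEquiv fun _ => .inl hi, Iff.rfl⟩
    have hroot : RootedIso (T 0) (r 0) (t.attach ⊥ ()) (t.root ()) :=
      ⟨⟨Equiv.subtypeUnivEquiv fun _ => .inl rfl, Iff.rfl⟩, rfl⟩
    obtain ⟨f⟩ := PlaneTree.nonempty_cycleAttach_iso (T := T) (r := r) (i₀ := 0)
      (fun i hi => hsub i fun h => hi (Fin.ext h)) hroot
    refine ⟨V, T, r, fun i => ?_, fun i hi => ?_, ⟨e.trans f.symm⟩⟩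
    · by_cases hi : i.val = 0
      · exact (e0 i hi).isTree_iff.2 t.isTree_attach
      · have := hsub i hi
        have : Nonempty (V i) := ⟨r i⟩
        exact .of_subsingleton
    · have := hsub i hi
      have : Nonempty (V i) := ⟨r i⟩
      exact Nat.card_eq_one_iff_unique.2 ⟨inferInstance, inferInstance⟩

theorem det_lapMat_eq_total {V : Type*} [Fintype V] [DecidableEq V] {G : SimpleGraph V} {k : ℕ}
    {t : PlaneTree} (e : G ≃g t.attach (cycleGraph (k + 3)) 0) :
    G.lapMat.det = (LapPair.cyc (k + 2) * t.pair).total := by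
  classical
  have := Fintype.ofFinite (t.Vert (Fin (k + 3)))
  have h := t.lapPair_attach (cycleGraph (k + 3)) 0
  have h' : (cycleGraph (k + 3)).lapMat.lapPair 0 = LapPair.cyc (k + 2) := by
    rw [lapMat_cycleGraph, Matrix.lapPair_cycleMatrix (by omega)]
  rw [det_lapMat_iso e, mul_comm, ← h']
  refine Eq.trans ?_ ((congrArg LapPair.total h).trans (by congr!))
  simp only [Matrix.lapPair]

end SimpleGraph

/-! ### The order on graphs and the main theorem -/

open SimpleGraph

section
variable {V W : Type*} [Fintype V] [Fintype W] {G : SimpleGraph V} {H : SimpleGraph W}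

theorem lapLT_of_posCoeff [DecidableEq V] [DecidableEq W] (hc : Fintype.card V = Fintype.card W)
    (h : PosCoeff (H.lapMat.det - G.lapMat.det)) : LapLT G H := by
  refine ⟨⟨hc, fun k hk => ?_⟩, ?_⟩
  · rw [lapCoeff_eq_coeff G hk, lapCoeff_eq_coeff H (hc ▸ hk)]
    simpa using h.1 k
  · by_contra! hle
    refine h.2.ne' ?_
    have : H.lapMat.det - G.lapMat.det = 0 := by
      ext k
      rcases le_or_gt k (Fintype.card V) with hk | hk
      · have h1 := hle k hk
        rw [lapCoeff_eq_coeff G hk, lapCoeff_eq_coeff H (hc ▸ hk)] at h1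
        have h2 := h.1 k
        simp only [coeff_sub, coeff_zero] at h2 ⊢
        omega
      · simp [coeff_det_lapMat_eq_zero G hk, coeff_det_lapMat_eq_zero H (hc ▸ hk)]
    simp [this]

theorem LapLT.trans {n : ℕ} {G H K : SimpleGraph (Fin n)} (h : LapLT G H) (h' : LapLT H K) :
    LapLT G K := by
  obtain ⟨k, hk, hlt⟩ := h.2
  exact ⟨⟨rfl, fun k hk => (h.1.2 k hk).trans (h'.1.2 k hk)⟩, k, hk, hlt.trans_le (h'.1.2 k hk)⟩

/-- Below every graph which is not minimal there is a minimal one. -/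
theorem exists_isLapMinimal_lapLT {n : ℕ} {S : Set (SimpleGraph (Fin n))} {G H : SimpleGraph (Fin n)}
    (hH : H ∈ S) (h : LapLT H G) : ∃ K, IsLapMinimal S K ∧ LapLT K G := by
  -- The sum of all Laplacian coefficients is strictly monotone for `≺`.
  obtain ⟨K, ⟨hK, hKG⟩, hmin⟩ := Set.exists_min_image {K | K ∈ S ∧ LapLT K G}
    (fun K => ∑ k ∈ Finset.range (n + 1), lapCoeff K k) (Set.toFinite _) ⟨H, hH, h⟩
  refine ⟨K, ⟨hK, fun L hL hLK => ?_⟩, hKG⟩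
  refine (hmin L ⟨hL, hLK.trans hKG⟩).not_gt (Finset.sum_lt_sum (fun k hk => ?_) ?_)
  · exact hLK.1.2 k (by simpa [Nat.lt_succ_iff] using hk)
  · obtain ⟨k, hk, hlt⟩ := hLK.2
    exact ⟨k, by simpa [Nat.lt_succ_iff] using hk, hlt⟩

end

/-- For `i ≥ 1` the `0` in the maximum plays no role, and clearing the denominator gives the
condition on the legs. The left side being positive, the truncated subtraction does no harm. -/
theorem le_floor_param_iff {n l k p i : ℕ}
    (hp : (p : ℤ) = max 0 ⌊((n : ℚ) - (k + 3 : ℕ) - (k + 3 : ℕ) * l + l) / (l + 1)⌋) (hl : 0 < l)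
    (hi : 1 ≤ i) : i ≤ p ↔ l * (k + 2 + i) ≤ n - (k + 3) - i := by
  have hpos : (0 : ℚ) < l + 1 := by positivity
  rw [← Int.ofNat_le, hp, le_max_iff, or_iff_right (by omega), Int.le_floor, le_div_iff₀ hpos]
  have h1 : ((i : ℤ) : ℚ) * (l + 1) ≤ (n : ℚ) - (k + 3 : ℕ) - (k + 3 : ℕ) * l + l ↔
      (i : ℤ) * (l + 1) ≤ (n : ℤ) - (k + 3) - (k + 3) * l + l := by
    rw [← Int.cast_le (R := ℚ)]
    push_cast
    rfl
  rw [h1]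
  have h2 : 0 < l * (k + 2 + i) := by positivity
  zify at h2
  constructor
  · intro h
    have : k + 3 + i ≤ n := by zify; nlinarith
    zify [show i ≤ n - (k + 3) by omega, show k + 3 ≤ n by omega]
    nlinarith
  · intro h
    have h3 : k + 3 + i ≤ n := by zify at h; omega
    zify [show i ≤ n - (k + 3) by omega, show k + 3 ≤ n by omega] at h
    nlinarith

theorem theorem3p3 (n l g p : ℕ) (hg : 3 ≤ g) (hl : 2 ≤ l) (hn : g + l ≤ n)
    (hp : (p : ℤ) = max 0 ⌊((n : ℚ) - g - g * l + l) / (l + 1)⌋) :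
    (∀ i ≤ p, Fintype.card (StarUniVertex n l g i) = n) ∧
    (∀ G : SimpleGraph (Fin n),
      IsLapMinimal (singleRootClass n l g) G ↔ ∃ i ≤ p, Nonempty (G ≃g starUni n l g i)) ∧
    (∀ i ≤ p, ∀ j ≤ p, i ≠ j →
      IsEmpty (starUni n l g i ≃g starUni n l g j) ∧
      ¬ LapLE (starUni n l g i) (starUni n l g j) ∧
      ¬ LapLE (starUni n l g j) (starUni n l g i)) := by
  classical
  obtain ⟨k, rfl⟩ := Nat.exists_eq_add_of_le' hg
  have hip : ∀ i, 1 ≤ i → (i ≤ p ↔ l * (k + 2 + i) ≤ n - (k + 3) - i) :=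
    fun i => le_floor_param_iff hp (by omega)
  have hle : ∀ i ≤ p, i + l ≤ n - (k + 3) := by
    intro i hi
    rcases Nat.eq_zero_or_pos i with rfl | h0
    · omega
    · have h1 := (hip i h0).1 hi
      have h2 : l * 1 ≤ l * (k + 2 + i) := Nat.mul_le_mul_left _ (by omega)
      omega
  have hiso : ∀ i ≤ p, Nonempty (starUni n l (k + 3) i ≃g
      (PlaneTree.starTree (n - (k + 3)) l i).attach (cycleGraph (k + 3)) 0) :=
    fun i hi => nonempty_starUni_iso (by omega) (hle i hi)
  have hcard : ∀ i ≤ p, Fintype.card (StarUniVertex n l (k + 3) i) = n := by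
    intro i hi
    obtain ⟨e⟩ := hiso i hi
    rw [← Nat.card_eq_fintype_card, Nat.card_congr e.toEquiv, PlaneTree.card_vert,
      PlaneTree.size_starTree (by omega) (hle i hi), Nat.card_fin]
    omega
  set T := fun i => (LapPair.cyc (k + 2) * (PlaneTree.starTree (n - (k + 3)) l i).pair).total with hT
  have hdet : ∀ i ≤ p, (starUni n l (k + 3) i).lapMat.det = T i := by
    intro i hi
    obtain ⟨e⟩ := hiso i hi
    exact det_lapMat_eq_total e
  have hinc : ∀ i ≤ p, ∀ j ≤ p, i ≠ j → ∃ m ≤ n, (T i).coeff m < (T j).coeff m := by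
    have key : ∀ i j, i < j → j ≤ p → (T i).coeff (2 * i + 2) < (T j).coeff (2 * i + 2) ∧
        (T j).coeff (n - (k + 3) + (k + 1)) < (T i).coeff (n - (k + 3) + (k + 1)) :=
      fun i j hij hj => PlaneTree.starTree_incomparable (k := k + 1) hl
        (fun i h1 h2 => (hip i h1).1 h2) hij hj
    intro i hi j hj hij
    rcases lt_or_gt_of_ne hij with h | h
    · refine ⟨_, ?_, (key i j h hj).1⟩
      have h1 := (hip j (by omega)).1 hj
      have h2 : 2 * (k + 2 + j) ≤ l * (k + 2 + j) := Nat.mul_le_mul_right _ hl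
      omega
    · exact ⟨_, by omega, (key j i h hi).2⟩
  have hnle : ∀ i ≤ p, ∀ j ≤ p, i ≠ j →
      ¬ LapLE (starUni n l (k + 3) i) (starUni n l (k + 3) j) := by
    intro i hi j hj hij h
    obtain ⟨m, hm, hlt⟩ := hinc j hj i hi hij.symm
    refine hlt.not_ge ?_
    have := h.2 m (by rwa [hcard i hi])
    rwa [lapCoeff_eq_coeff _ (by rwa [hcard i hi]), lapCoeff_eq_coeff _ (by rwa [hcard j hj]),
      hdet i hi, hdet j hj] at this
  have hmin : ∀ G : SimpleGraph (Fin n), IsLapMinimal (singleRootClass n l (k + 3)) G →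
      ∃ i ≤ p, Nonempty (G ≃g starUni n l (k + 3) i) := by
    rintro G ⟨hG, hGmin⟩
    obtain ⟨t, ht1, ht2, ⟨e⟩⟩ := (mem_singleRootClass_iff (by omega)).1 hG
    rcases PlaneTree.eq_stem_or_reducible_cyc (k := k + 2) (by omega) hl ht1 ht2 with
      ⟨i, L, rfl, hL, -, hi⟩ | ⟨t', h1, h2, h3⟩
    · have hi' : i ≤ p := by
        rcases Nat.eq_zero_or_pos i with h0 | h0
        · omega
        · exact (hip i h0).2 (hi.resolve_left (by omega))
      obtain ⟨f, -⟩ := (PlaneTree.Equivalent.legs hL).stem i _ (cycleGraph (k + 3)) 0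
      obtain ⟨e'⟩ := hiso i hi'
      exact ⟨i, hi', ⟨(e.trans f).trans e'.symm⟩⟩
    -- The smaller graph is transported to the vertex set `Fin n`.
    · have hc : Nat.card (t'.Vert (Fin (k + 3))) = Nat.card (Fin n) := by
        rw [PlaneTree.card_vert, h1, Nat.card_fin, Nat.card_fin]
        omega
      obtain ⟨φ⟩ := (Finite.card_eq).1 hc
      set H := (t'.attach (cycleGraph (k + 3)) 0).comap φ.symm
      have eH : H ≃g t'.attach (cycleGraph (k + 3)) 0 := ⟨φ.symm, Iff.rfl⟩
      refine (hGmin H ((mem_singleRootClass_iff (by omega)).2 ⟨t', h1, h2, ⟨eH⟩⟩) ?_).elim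
      apply lapLT_of_posCoeff rfl
      rwa [det_lapMat_eq_total e, det_lapMat_eq_total eH]
  refine ⟨hcard, fun G => ⟨hmin G, ?_⟩, fun i hi j hj hij =>
    ⟨⟨fun e => ?_⟩, hnle i hi j hj hij, hnle j hj i hi hij.symm⟩⟩
  · rintro ⟨i, hi, ⟨e⟩⟩
    obtain ⟨e'⟩ := hiso i hi
    refine ⟨(mem_singleRootClass_iff (by omega)).2 ⟨_, PlaneTree.size_starTree (by omega) (hle i hi),
      PlaneTree.leaves_starTree (by omega), ⟨e.trans e'⟩⟩, fun H hH hHG => ?_⟩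
    -- A minimal graph below `G` is some `U^j`: `j = i` contradicts strictness, `j ≠ i`
    -- incomparability.
    obtain ⟨K, hK, hKG, m, hm, hlt⟩ := exists_isLapMinimal_lapLT hH hHG
    obtain ⟨j, hj, ⟨f⟩⟩ := hmin K hK
    have hGT : ∀ m ≤ n, lapCoeff G m = (T i).coeff m := fun m hm => by
      rw [lapCoeff_eq_coeff _ (by simpa using hm), det_lapMat_iso e, hdet i hi]
    have hKT : ∀ m ≤ n, lapCoeff K m = (T j).coeff m := fun m hm => by
      rw [lapCoeff_eq_coeff _ (by simpa using hm), det_lapMat_iso f, hdet j hj]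
    rw [Fintype.card_fin] at hm
    rcases eq_or_ne i j with rfl | hij
    · rw [hGT m hm, hKT m hm] at hlt
      exact hlt.false
    · obtain ⟨m, hm, hlt⟩ := hinc i hi j hj hij
      have := hKG.2 m (by simpa using hm)
      rw [hGT m hm, hKT m hm] at this
      exact hlt.not_ge this
  · obtain ⟨m, -, hlt⟩ := hinc i hi j hj hij
    rw [← hdet i hi, ← hdet j hj, det_lapMat_iso e] at hlt
    exact hlt.false

end
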